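/- **Theorem (Expressiveness of FO({PartOf})).** *Triangles.* A triangle is a triple $T=(a_1,a_2,a_3)$ of points of $\mathbb{R}^2$ (corner points may coincide). Its drawing is the convex hull of $\{a_1,a_2,a_3\}$. $\mathrm{PartOf}(T_1,T_2)$ means that the drawing of $T_1$ is contained in the drawing of $T_2$, and $T_1=_{\triangle}T_2$ means $\mathrm{PartOf}(T_1,T_2)$ and $\mathrm{PartOf}(T_2,T_1)$. Identify $((\mathbb{R}^2)^3)^k$ with $\mathbb{R}^{6k}$ by listing coordinates. *Relations and databases.* A semi-algebraic relation in $\mathbb{R}^n$ is a Boolean combination of sets $\{x : p(x)>0\}$ with $p$ a polynomial with integer coefficients. A spatial triangle relation of arity $k$ is a set $C\subseteq((\mathbb{R}^2)^3)^k$ which is semi-algebraic as a subset of $\mathbb{R}^{6k}$ and consistent: if $(T_1,\dots,T_k)\in C$ and $T_i'$ has the same drawing as $T_i$ for every $i$, then $(T_1',\dots,T_k')\in C$. A schema $\hat\sigma$ is a finite set of relation names $\hat R$ with arities $ar(\hat R)\in\mathbb{N}$; a triangle database over $\hat\sigma$ assigns to each $\hat R$ a spatial triangle relation of arity $ar(\hat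 R)$. *Queries.* A $k$-ary query $Q$ assigns to every triangle database over $\hat\sigma$ a spatial triangle relation of arity $k$. Affinities $x\mapsto Ax+b$ of $\mathbb{R}^2$ ($A$ an invertible matrix) act on triangles corner point by corner point. $Q$ is affine-generic if $Q(D')=g(Q(D))$ for all triangle databases $D,D'$ over $\hat\sigma$ and every affinity $g$ with $D'=g(D)$. $Q$ is an FO$(+,\times,<,0,1)[\overline{\sigma}]$-query if there is a first-order formula $\psi$ with $6k$ free real variables, built from the atoms $p>0$ ($p$ a polynomial with integer coefficients) and $\overline R(t_1,\dots,t_{6\,ar(\hat R)})$ ($\hat R\in\hat\sigma$, the $t_i$ such polynomials), where $\overline R$ is interpreted by the relation of $\hat R$ in coordinates and quantifiers range over $\mathbb{R}$, such that for every triangle database $D$ the formula $\psi$ defines $Q(D)$ in coordinates. *The triangle logic.* FO$(\{\mathrm{PartOf}\})[\hat\sigma]$ is first-order logic with variables ranging over triangles and atoms $T_1=_{\triangle}T_2$, $\mathrm{PartOf}(T_1,T_2)$ and $\hat R(T_1,\dots,T_{ar(\hat R)})$. A formula $\varphi(T_1,\dots,T_k)$ expresses $Q$ if, for every triangle database $D$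 over $\hat\sigma$, $Q(D)$ is the set of $k$-tuples of triangles that satisfy $\varphi$ in $D$. *Statement.* For every schema $\hat\sigma$, FO$(\{\mathrm{PartOf}\})[\hat\sigma]$ is sound and complete for the affine-generic FO$(+,\times,<,0,1)[\overline\sigma]$-queries on triangle databases over $\hat\sigma$. That is, for every $k\ge 0$: (soundness) every FO$(\{\mathrm{PartOf}\})[\hat\sigma]$-formula with $k$ free variables expresses a $k$-ary query, and that query is an affine-generic FO$(+,\times,<,0,1)[\overline\sigma]$-query; (completeness) every $k$-ary affine-generic FO$(+,\times,<,0,1)[\overline\sigma]$-query is expressed by some FO$(\{\mathrm{PartOf}\})[\hat\sigma]$-formula. -/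

import Mathlib

/-! ### Semi-algebraic sets -/

/-- Semi-algebraic relations in `ℝ^ι`: Boolean combinations of sets `{x | p x > 0}`
with `p` a polynomial with integer coefficients. -/
inductive IsSemialgebraic {ι : Type} : Set (ι → ℝ) → Prop
  | pos (p : MvPolynomial ι ℤ) : IsSemialgebraic {x | 0 < MvPolynomial.aeval x p}
  | compl {s : Set (ι → ℝ)} : IsSemialgebraic s → IsSemialgebraic sᶜ
  | inter {s t : Set (ι → ℝ)} : IsSemialgebraic s → IsSemialgebraic t → IsSemialgebraic (s ∩ t)
  | union {s t : Set (ι → ℝ)} : IsSemialgebraic s → IsSemialgebraic t → IsSemialgebraic (s ∪ t)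

/-! ### Triangles in the plane -/

/-- Points of the plane `ℝ²`. -/
abbrev PlanePoint : Type := Fin 2 → ℝ

/-- A triangle is an arbitrary triple of points; the corner points may coincide. -/
abbrev Triangle : Type := Fin 3 → PlanePoint

/-- The drawing of a triangle: the convex closure of its corner points. -/
def Triangle.drawing (T : Triangle) : Set PlanePoint := convexHull ℝ (Set.range T)

/-- The predicate `PartOf`. -/
def Triangle.PartOf (T₁ T₂ : Triangle) : Prop := T₁.drawing ⊆ T₂.drawing

/-- Equality of triangles, in the sense of the triangle logic. -/
def Triangle.TriEq (T₁ T₂ : Triangle) : Prop := T₁.PartOf T₂ ∧ T₂.PartOf T₁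

/-- The affinities `x ↦ A x + b` of the plane, `A` regular. -/
abbrev Affinity : Type := PlanePoint ≃ᵃ[ℝ] PlanePoint

/-- The image of a tuple of triangles under an affinity, taken corner point by corner point. -/
def Affinity.mapTuple {k : ℕ} (g : Affinity) (c : Fin k → Triangle) : Fin k → Triangle :=
  fun i j => g (c i j)

/-- Index set of the `6k` real coordinates of a `k`-tuple of triangles. -/
abbrev CoordIndex (k : ℕ) : Type := Fin k × Fin 3 × Fin 2

/-- The canonical bijection from `k`-tuples of triangles to `ℝ^{6k}`. -/
def canonicalBijection (k : ℕ) : (Fin k → Triangle) ≃ (CoordIndex k → ℝ) where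
  toFun c := fun p => c p.1 p.2.1 p.2.2
  invFun x := fun i j l => x (i, j, l)
  left_inv _ := rfl
  right_inv _ := rfl

/-! ### Triangle relations, databases and queries -/

/-- A database schema: a finite set of relation names with arities. -/
structure TriangleSchema where
  Name : Type
  finite_name : Finite Name
  arity : Name → ℕ

/-- Consistency: membership of a tuple depends only on the drawings of its triangles. -/
def IsConsistent {k : ℕ} (C : Set (Fin k → Triangle)) : Prop :=
  ∀ c c' : Fin k → Triangle, (∀ i, (c i).drawing = (c' i).drawing) → c ∈ C → c' ∈ C

/-- A spatial triangle relation of arity `k`. -/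
structure TriangleRelation (k : ℕ) where
  carrier : Set (Fin k → Triangle)
  semialgebraic : IsSemialgebraic (canonicalBijection k '' carrier)
  consistent : IsConsistent carrier

/-- A spatial triangle database over `σ`. -/
structure TriangleDatabase (σ : TriangleSchema) where
  rel : (R : σ.Name) → TriangleRelation (σ.arity R)

/-- `D'` is the image of `D` under the affinity `g`. -/
def TriangleDatabase.IsImage {σ : TriangleSchema} (g : Affinity) (D D' : TriangleDatabase σ) :
    Prop :=
  ∀ R : σ.Name, (D'.rel R).carrier = g.mapTuple '' (D.rel R).carrier

/-- A `k`-ary triangle database query over `σ`. -/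
abbrev TriangleQuery (σ : TriangleSchema) (k : ℕ) : Type :=
  TriangleDatabase σ → TriangleRelation k

/-- Affine-genericity of a query. -/
def TriangleQuery.AffineGeneric {σ : TriangleSchema} {k : ℕ} (Q : TriangleQuery σ k) : Prop :=
  ∀ (g : Affinity) (D D' : TriangleDatabase σ), D.IsImage g D' →
    (Q D').carrier = g.mapTuple '' (Q D).carrier

/-! ### The triangle logic with the predicate `PartOf` -/

/-- Formulas of `FO({PartOf})` over `σ` whose free variables are among `n` triangle variables;
a quantifier binds the last of `n + 1` variables. -/
inductive TriangleFormula (σ : TriangleSchema) : ℕ → Type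
  | eq {n : ℕ} (i j : Fin n) : TriangleFormula σ n
  | partOf {n : ℕ} (i j : Fin n) : TriangleFormula σ n
  | rel {n : ℕ} (R : σ.Name) (v : Fin (σ.arity R) → Fin n) : TriangleFormula σ n
  | not {n : ℕ} (φ : TriangleFormula σ n) : TriangleFormula σ n
  | and {n : ℕ} (φ ψ : TriangleFormula σ n) : TriangleFormula σ n
  | or {n : ℕ} (φ ψ : TriangleFormula σ n) : TriangleFormula σ n
  | ex {n : ℕ} (φ : TriangleFormula σ (n + 1)) : TriangleFormula σ n
  | all {n : ℕ} (φ : TriangleFormula σ (n + 1)) : TriangleFormula σ n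

/-- Satisfaction of a triangle formula in a triangle database by a tuple of triangles. -/
def TriangleFormula.Realize {σ : TriangleSchema} (D : TriangleDatabase σ) :
    {n : ℕ} → TriangleFormula σ n → (Fin n → Triangle) → Prop
  | _, .eq i j, c => (c i).TriEq (c j)
  | _, .partOf i j, c => (c i).PartOf (c j)
  | _, .rel R v, c => (fun l => c (v l)) ∈ (D.rel R).carrier
  | _, .not φ, c => ¬ φ.Realize D c
  | _, .and φ ψ, c => φ.Realize D c ∧ ψ.Realize D c
  | _, .or φ ψ, c => φ.Realize D c ∨ ψ.Realize D c
  | _, .ex φ, c => ∃ T : Triangle, φ.Realize D (Fin.snoc (α := fun _ => Triangle) c T)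
  | _, .all φ, c => ∀ T : Triangle, φ.Realize D (Fin.snoc (α := fun _ => Triangle) c T)

/-- The triangle formula `φ` expresses the query `Q`. -/
def TriangleFormula.Expresses {σ : TriangleSchema} {k : ℕ} (φ : TriangleFormula σ k)
    (Q : TriangleQuery σ k) : Prop :=
  ∀ D : TriangleDatabase σ, (Q D).carrier = {c | φ.Realize D c}

/-! ### First-order logic over the reals with polynomial constraints -/

/-- Formulas of `FO(+, ×, <, 0, 1)` over the constraint schema that has, for each relation name
`R` of `σ`, a relation name of arity `6 * arity R`. The free real variables are indexed by `α`,
the `n` bound ones by `Fin n`. Real terms are polynomials with integer coefficients. -/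
inductive RealFormula (σ : TriangleSchema) (α : Type) : ℕ → Type
  | pos {n : ℕ} (p : MvPolynomial (α ⊕ Fin n) ℤ) : RealFormula σ α n
  | rel {n : ℕ} (R : σ.Name) (t : CoordIndex (σ.arity R) → MvPolynomial (α ⊕ Fin n) ℤ) :
      RealFormula σ α n
  | not {n : ℕ} (φ : RealFormula σ α n) : RealFormula σ α n
  | and {n : ℕ} (φ ψ : RealFormula σ α n) : RealFormula σ α n
  | or {n : ℕ} (φ ψ : RealFormula σ α n) : RealFormula σ α n
  | ex {n : ℕ} (φ : RealFormula σ α (n + 1)) : RealFormula σ α n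
  | all {n : ℕ} (φ : RealFormula σ α (n + 1)) : RealFormula σ α n

/-- Satisfaction of a real formula in the constraint database that a triangle database becomes
under the canonical bijections; `x` assigns the free and `y` the bound variables. -/
def RealFormula.Realize {σ : TriangleSchema} {α : Type} (D : TriangleDatabase σ) :
    {n : ℕ} → RealFormula σ α n → (α → ℝ) → (Fin n → ℝ) → Prop
  | _, .pos p, x, y => 0 < MvPolynomial.aeval (Sum.elim x y) p
  | _, .rel R t, x, y =>
      (fun l => MvPolynomial.aeval (Sum.elim x y) (t l)) ∈
        canonicalBijection (σ.arity R) '' (D.rel R).carrier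
  | _, .not φ, x, y => ¬ φ.Realize D x y
  | _, .and φ ψ, x, y => φ.Realize D x y ∧ ψ.Realize D x y
  | _, .or φ ψ, x, y => φ.Realize D x y ∨ ψ.Realize D x y
  | _, .ex φ, x, y => ∃ a : ℝ, φ.Realize D x (Fin.snoc (α := fun _ => ℝ) y a)
  | _, .all φ, x, y => ∀ a : ℝ, φ.Realize D x (Fin.snoc (α := fun _ => ℝ) y a)

/-- `Q` is an `FO(+, ×, <, 0, 1)`-query: some formula with `6k` free real variables defines its
result, read in coordinates, on every triangle database. -/
def TriangleQuery.IsFirstOrder {σ : TriangleSchema} {k : ℕ} (Q : TriangleQuery σ k) : Prop :=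
  ∃ ψ : RealFormula σ (CoordIndex k) 0, ∀ D : TriangleDatabase σ,
    canonicalBijection k '' (Q D).carrier = {x | ψ.Realize D x Fin.elim0}

/-!
Soundness. Read in coordinates, a triangle formula becomes a first-order formula over the reals
(`TriangleFormula.realDefinable`), because `PartOf` is semialgebraic. Its truth depends only on the
drawings of the triangles and is invariant under affinities, by induction on the formula. That the
relation it defines on a given database is again semialgebraic, with integer coefficients, is the
Tarski–Seidenberg theorem (`IsSemialgebraic.exists_option`). The proof of the latter follows Cohen
and Hörmander, in the following form: for finitely many polynomials `f` in one variable with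
coefficients in a ring `A` there are finitely many elements of `A` whose signs at a parameter
determine the sign diagram of the polynomials `f` on the line up to an order automorphism
(`Polynomial.exists_finite_sign_determining`). A projection is then a union of sign classes of
finitely many polynomials.

Completeness. In the triangle logic the points are the triangles that are minimal for `PartOf`, and
a point lies on the segment `pq` when it lies in every triangle that contains `p` and `q`. So
parallelism is expressible, and relative to an affine frame also the addition and multiplication of
the points of the first axis. In this way every real formula can be evaluated relative to a frame
(`RealFormula.realExpressible`). If the frame is the image of the standard one under an affinity
`g`, this evaluates the formula in the inverse image of the database under `g`, so that by
genericity the result does not depend on the frame.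

This argument needs the inverse image to be a database, and it may fail to be semialgebraic over
the integers when `g` has transcendental coefficients. Nothing is known about such frames, so it
would not do to ask for the truth of the formula relative to some frame, or to all frames. Instead,
the formula asks for three nondegenerate triangles such that every choice of one point from each is
a frame relative to which the query holds. If there are such triangles, then they contain a
rational frame, for which the inverse image is a database, and the query holds. Conversely, if the
query holds then it holds relative to all rational frames; since the set of frames relative to
which it holds is semialgebraic, by soundness, it is a neighbourhood of any rational frame that
avoids the zeros of a certain nonzero polynomial (`Expressible.exists_triangles_of_rat`).
-/

/-! ### Sign diagrams of real polynomials -/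

open Polynomial in
/-- A real polynomial without a zero between two points has the same sign at both. -/
lemma Polynomial.sign_eval_eq_of_ne_zero (p : ℝ[X]) {a b : ℝ}
    (h : ∀ t ∈ Set.uIcc a b, p.eval t ≠ 0) :
    SignType.sign (p.eval a) = SignType.sign (p.eval b) := by
  have ha : p.eval a ≠ 0 := h a Set.left_mem_uIcc
  have hb : p.eval b ≠ 0 := h b Set.right_mem_uIcc
  have key : (0 : ℝ) ∉ Set.uIcc (p.eval a) (p.eval b) := by
    intro h0
    obtain ⟨t, ht, ht0⟩ := intermediate_value_uIcc (p.continuous.continuousOn) h0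
    exact h t ht ht0
  rw [Set.mem_uIcc] at key
  push Not at key
  rcases lt_or_gt_of_ne ha with h1 | h1 <;> rcases lt_or_gt_of_ne hb with h2 | h2
  · rw [sign_neg h1, sign_neg h2]
  · exact absurd (key.1 h1.le) (not_lt.2 h2.le)
  · exact absurd (key.2 h2.le) (not_lt.2 h1.le)
  · rw [sign_pos h1, sign_pos h2]

/-- A strictly monotone function on a finite set of reals extends to an order automorphism
of the real line. -/
lemma exists_orderIso_eqOn (Z : Finset ℝ) (w : ℝ → ℝ) (hw : StrictMonoOn w Z) :
    ∃ h : ℝ ≃o ℝ, ∀ z ∈ Z, h z = w z := by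
  induction Z using Finset.induction_on_max with
  | empty => exact ⟨OrderIso.refl ℝ, by simp⟩
  | insert b Z hb ih =>
    obtain ⟨h, hh⟩ := ih (hw.mono (by simp))
    -- a fixed point `c` of the correction, above `w z` for `z ∈ Z` and below `w b` and `h b`
    obtain ⟨c, hc, hcb, hcw⟩ : ∃ c, (∀ z ∈ Z, w z ≤ c) ∧ c < h b ∧ c < w b := by
      rcases Z.eq_empty_or_nonempty with rfl | hne
      · exact ⟨min (h b) (w b) - 1, by simp, by linarith [min_le_left (h b) (w b)],
          by linarith [min_le_right (h b) (w b)]⟩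
      · have hm := Z.max'_mem hne
        refine ⟨w (Z.max' hne), fun z hz => ?_, ?_, ?_⟩
        · exact hw.monotoneOn (by simp [hz]) (by simp [hm]) (Z.le_max' z hz)
        · rw [← hh _ hm]; exact h.strictMono (hb _ hm)
        · exact hw (by simp [hm]) (by simp) (hb _ hm)
    set r : ℝ := (w b - c) / (h b - c) with hr
    have hr0 : 0 < r := div_pos (by linarith) (by linarith)
    let k : ℝ → ℝ := fun t => if t ≤ c then t else c + r * (t - c)
    have kmono : StrictMono k := by
      intro s t hst
      simp only [k]
      split_ifs with h1 h2 h2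
      · exact hst
      · have := mul_pos hr0 (sub_pos.2 (not_le.1 h2)); linarith
      · linarith
      · have := mul_lt_mul_of_pos_left hst hr0; linarith
    have ksurj : Function.Surjective k := by
      intro y
      by_cases hy : y ≤ c
      · exact ⟨y, by simp [k, hy]⟩
      · refine ⟨c + (y - c) / r, ?_⟩
        have h1 : ¬ (c + (y - c) / r ≤ c) := by
          have := div_pos (sub_pos.2 (not_le.1 hy)) hr0; linarith
        simp only [k, h1, if_false]
        field_simp
        ring
    refine ⟨h.trans (kmono.orderIsoOfSurjective k ksurj), fun z hz => ?_⟩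
    simp only [OrderIso.trans_apply, StrictMono.coe_orderIsoOfSurjective]
    rcases Finset.mem_insert.1 hz with rfl | hz
    · have h1 : ¬ (h z ≤ c) := not_le.2 hcb
      have h2 : h z - c ≠ 0 := by linarith
      simp only [k, h1, if_false, hr]
      field_simp
      ring
    · simp [k, hh z hz, hc z hz]

open Polynomial in
/-- An order automorphism that matches the signs of `p` and `q` may be replaced by any other one
that agrees with it on the zeros of `p`. -/
lemma Polynomial.sign_match_of_agree {p q : ℝ[X]} {h h' : ℝ ≃o ℝ} {Z : Finset ℝ}
    (hh : ∀ z ∈ Z, h' z = h z)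
    (hm : ∀ t, SignType.sign (p.eval t) = SignType.sign (q.eval (h t)))
    (hZ : ∀ t, p.eval t = 0 → t ∈ Z) (t : ℝ) :
    SignType.sign (p.eval t) = SignType.sign (q.eval (h' t)) := by
  by_cases ht : t ∈ Z
  · rw [hh t ht, hm]
  rw [hm]
  apply sign_eval_eq_of_ne_zero
  intro u hu hu0
  obtain ⟨z, rfl⟩ := h.surjective u
  have hz : z ∈ Z := hZ z (by rw [← sign_eq_zero_iff, hm, hu0, sign_zero])
  apply ht
  rcases Set.mem_uIcc.1 hu with ⟨h1, h2⟩ | ⟨h1, h2⟩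
  · rw [← hh z hz] at h2
    rwa [le_antisymm (h.le_iff_le.1 h1) (h'.le_iff_le.1 h2)]
  · rw [← hh z hz] at h1
    rwa [le_antisymm (h'.le_iff_le.1 h1) (h.le_iff_le.1 h2)]

open Polynomial Filter in
lemma Polynomial.eventually_sign_eval_atTop (P : ℝ[X]) :
    ∀ᶠ x in atTop, SignType.sign (P.eval x) = SignType.sign P.leadingCoeff := by
  rcases eq_or_ne P.natDegree 0 with h0 | h0
  · rw [natDegree_eq_zero] at h0
    obtain ⟨c, rfl⟩ := h0
    simp
  have hdeg : 0 < P.degree := natDegree_pos_iff_degree_pos.1 (Nat.pos_of_ne_zero h0)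
  have hl : P.leadingCoeff ≠ 0 := leadingCoeff_ne_zero.2 (by rintro rfl; simp at h0)
  rcases lt_or_gt_of_ne hl with h | h
  · filter_upwards [(P.tendsto_atBot_of_leadingCoeff_nonpos hdeg h.le).eventually_lt_atBot 0]
      with x hx
    rw [sign_neg hx, sign_neg h]
  · filter_upwards [(P.tendsto_atTop_of_leadingCoeff_nonneg hdeg h.le).eventually_gt_atTop 0]
      with x hx
    rw [sign_pos hx, sign_pos h]

open Polynomial Filter in
lemma Polynomial.eventually_sign_eval_atBot (P : ℝ[X]) :
    ∀ᶠ x in atBot, SignType.sign (P.eval x) =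
      SignType.sign (P.leadingCoeff * (-1) ^ P.natDegree) := by
  have h := (tendsto_neg_atBot_atTop (G := ℝ)).eventually
    (P.comp (-X)).eventually_sign_eval_atTop
  filter_upwards [h] with x hx
  rw [← neg_neg x]
  simpa [leadingCoeff_comp] using hx

open Polynomial in
/-- Across an interval in whose interior `P'` has no zero, `P` moves in the direction given by the
sign of `P'` at any point of the closed interval where `P'` does not vanish. -/
lemma Polynomial.sign_eval_sub_eval (P : ℝ[X]) {u t s : ℝ} (hut : u < t) (hs : s ∈ Set.Icc u t)
    (hne : ∀ x ∈ Set.Ioo u t, P.derivative.eval x ≠ 0) (hs0 : P.derivative.eval s ≠ 0) :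
    SignType.sign (P.eval t - P.eval u) = SignType.sign (P.derivative.eval s) := by
  obtain ⟨ξ, hξ, he⟩ := exists_deriv_eq_slope (fun x => P.eval x) hut
    P.continuous.continuousOn P.differentiable.differentiableOn
  have h1 : P.eval t - P.eval u = P.derivative.eval ξ * (t - u) := by
    rw [Polynomial.deriv] at he
    rw [he, div_mul_cancel₀ _ (sub_pos.2 hut).ne']
  rw [h1, sign_mul, sign_pos (sub_pos.2 hut), mul_one]
  apply sign_eval_eq_of_ne_zero
  intro x hx
  by_cases hxs : x = s
  · rwa [hxs]
  apply hne
  rcases Set.mem_uIcc.1 hx with ⟨h2, h3⟩ | ⟨h2, h3⟩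
  · exact ⟨hξ.1.trans_le h2, (lt_of_le_of_ne h3 hxs).trans_le hs.2⟩
  · exact ⟨hs.1.trans_lt (lt_of_le_of_ne h2 (Ne.symm hxs)), h3.trans_lt hξ.2⟩

open Polynomial in
lemma Polynomial.exists_derivative_eq_zero (P : ℝ[X]) {r s : ℝ} (hrs : r < s)
    (hr : P.eval r = 0) (hs : P.eval s = 0) :
    ∃ z ∈ Set.Ioo r s, P.derivative.eval z = 0 := by
  obtain ⟨z, hz, h0⟩ := exists_deriv_eq_zero (f := fun x => P.eval x) hrs
    P.continuous.continuousOn (by rw [hr, hs])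
  exact ⟨z, hz, by rwa [Polynomial.deriv] at h0⟩

open Polynomial in
/-- Suppose `h` carries the sign of `P` to the sign of `Q` on a finite set `Z` containing the zeros
of `P'`. Then a zero of `P` strictly between two points of `Z` has a counterpart among the zeros
of `Q`, in the corresponding gap of `h '' Z`: `P` is strictly monotone on a gap, so a zero is
detected by the signs at the two ends. -/
lemma Polynomial.exists_root_in_gap {P Q : ℝ[X]} {h : ℝ ≃o ℝ} {Z : Finset ℝ}
    (hz : ∀ z ∈ Z, SignType.sign (P.eval z) = SignType.sign (Q.eval (h z)))
    (hZ : ∀ t, P.derivative.eval t = 0 → t ∈ Z) {r : ℝ} (hr : P.eval r = 0) (hrZ : r ∉ Z)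
    (hlo : ∃ z ∈ Z, z < r) (hhi : ∃ z ∈ Z, r < z) :
    ∃ r', Q.eval r' = 0 ∧ ∀ z ∈ Z, (z < r → h z < r') ∧ (r < z → r' < h z) := by
  obtain ⟨a, ha, hamax⟩ := (Z.filter (· < r)).exists_max_image id
    (by obtain ⟨z, h1, h2⟩ := hlo; exact ⟨z, by simp [h1, h2]⟩)
  obtain ⟨b, hb, hbmin⟩ := (Z.filter (r < ·)).exists_min_image id
    (by obtain ⟨z, h1, h2⟩ := hhi; exact ⟨z, by simp [h1, h2]⟩)
  simp only [Finset.mem_filter, id] at ha hb hamax hbmin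
  have hr' : P.derivative.eval r ≠ 0 := fun h0 => hrZ (hZ r h0)
  have h1 := P.sign_eval_sub_eval ha.2 (Set.right_mem_Icc.2 ha.2.le)
    (fun x hx h0 => absurd (hamax x ⟨hZ x h0, hx.2⟩) (not_le.2 hx.1)) hr'
  have h2 := P.sign_eval_sub_eval hb.2 (Set.left_mem_Icc.2 hb.2.le)
    (fun x hx h0 => absurd (hbmin x ⟨hZ x h0, hx.1⟩) (not_le.2 hx.2)) hr'
  rw [hr, zero_sub, Left.sign_neg, hz a ha.1] at h1
  rw [hr, sub_zero, hz b hb.1] at h2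
  have hab : h a < h b := h.strictMono (ha.2.trans hb.2)
  have hQ : (0 : ℝ) ∈ Set.uIcc (Q.eval (h a)) (Q.eval (h b)) := by
    rw [Set.mem_uIcc]
    rcases lt_or_gt_of_ne hr' with h3 | h3
    · rw [sign_neg h3] at h1 h2
      rw [sign_eq_neg_one_iff] at h2
      rw [neg_eq_iff_eq_neg, neg_neg, sign_eq_one_iff] at h1
      exact Or.inr ⟨h2.le, h1.le⟩
    · rw [sign_pos h3] at h1 h2
      rw [sign_eq_one_iff] at h2
      rw [neg_eq_iff_eq_neg, sign_eq_neg_one_iff] at h1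
      exact Or.inl ⟨h1.le, h2.le⟩
  obtain ⟨r', hr'm, hr'0⟩ := intermediate_value_uIcc (Q.continuous.continuousOn) hQ
  rw [Set.uIcc_of_le hab.le] at hr'm
  have hQa : Q.eval (h a) ≠ 0 := fun h0 => hr' (by
    rwa [h0, sign_zero, neg_zero, eq_comm, sign_eq_zero_iff] at h1)
  have hQb : Q.eval (h b) ≠ 0 := fun h0 => hr' (by
    rwa [h0, sign_zero, eq_comm, sign_eq_zero_iff] at h2)
  have har : h a < r' := lt_of_le_of_ne hr'm.1 (fun h0 => hQa (by rw [h0]; exact hr'0))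
  have hbr : r' < h b := lt_of_le_of_ne hr'm.2 (fun h0 => hQb (by rw [← h0]; exact hr'0))
  exact ⟨r', hr'0, fun z hzZ => ⟨fun hzr => (h.monotone (hamax z ⟨hzZ, hzr⟩)).trans_lt har,
    fun hzr => hbr.trans_le (h.monotone (hbmin z ⟨hzZ, hzr⟩))⟩⟩

open Polynomial Filter in
/-- The analytic step of quantifier elimination: an order automorphism that matches the signs of
`P'` and `Q'` everywhere and those of `P` and `Q` on a finite set `Z` containing the zeros of `P'`
can be changed off `Z` so that it matches the signs of `P` and `Q` everywhere. -/
lemma Polynomial.exists_orderIso_sign_match {P Q : ℝ[X]} {h : ℝ ≃o ℝ} {Z : Finset ℝ}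
    (hP : P ≠ 0) (hQ : Q ≠ 0) (hdeg : P.natDegree = Q.natDegree)
    (hlead : SignType.sign P.leadingCoeff = SignType.sign Q.leadingCoeff)
    (hd : ∀ t, SignType.sign (P.derivative.eval t) = SignType.sign (Q.derivative.eval (h t)))
    (hz : ∀ z ∈ Z, SignType.sign (P.eval z) = SignType.sign (Q.eval (h z)))
    (hZ : ∀ t, P.derivative.eval t = 0 → t ∈ Z) :
    ∃ h' : ℝ ≃o ℝ, (∀ z ∈ Z, h' z = h z) ∧
      ∀ t, SignType.sign (P.eval t) = SignType.sign (Q.eval (h' t)) := by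
  -- points `lo` and `hi` outside of which nothing happens
  have hfin : (↑Z ∪ ↑P.roots.toFinset ∪ h ⁻¹' ↑Q.roots.toFinset : Set ℝ).Finite :=
    ((Finset.finite_toSet _).union (Finset.finite_toSet _)).union
      ((Finset.finite_toSet _).preimage h.injective.injOn)
  obtain ⟨hi, ⟨hhi1, hhi2⟩, hhi3⟩ := ((P.eventually_sign_eval_atTop.and
    (h.tendsto_atTop.eventually Q.eventually_sign_eval_atTop)).and
    (hfin.eventually_all.2 fun x _ => eventually_gt_atTop x)).exists
  obtain ⟨lo, ⟨hlo1, hlo2⟩, hlo3⟩ := ((P.eventually_sign_eval_atBot.and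
    (h.tendsto_atBot.eventually Q.eventually_sign_eval_atBot)).and
    (hfin.eventually_all.2 fun x _ => eventually_lt_atBot x)).exists
  have hloP : ∀ t, P.eval t = 0 → lo < t := fun t ht => hlo3 t (by simp [hP, ht])
  have hhiP : ∀ t, P.eval t = 0 → t < hi := fun t ht => hhi3 t (by simp [hP, ht])
  have hloQ : ∀ t, Q.eval (h t) = 0 → lo < t := fun t ht => hlo3 t (by simp [hQ, ht])
  have hhiQ : ∀ t, Q.eval (h t) = 0 → t < hi := fun t ht => hhi3 t (by simp [hQ, ht])
  set Z₁ : Finset ℝ := insert lo (insert hi Z) with hZ₁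
  have hloZ : lo ∈ Z₁ := by simp [hZ₁]
  have hhiZ : hi ∈ Z₁ := by simp [hZ₁]
  have hz₁ : ∀ z ∈ Z₁, SignType.sign (P.eval z) = SignType.sign (Q.eval (h z)) := by
    intro z hzm
    rcases Finset.mem_insert.1 hzm with rfl | hzm
    · rw [hlo1, hlo2, sign_mul, sign_mul, hlead, hdeg]
    rcases Finset.mem_insert.1 hzm with rfl | hzm
    · rw [hhi1, hhi2, hlead]
    · exact hz z hzm
  have hZ₁' : ∀ t, P.derivative.eval t = 0 → t ∈ Z₁ := fun t ht => by simp [hZ₁, hZ t ht]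
  have hZQ : ∀ t, Q.derivative.eval (h t) = 0 → t ∈ Z₁ := fun t ht =>
    hZ₁' t (by rw [← sign_eq_zero_iff, hd, ht, sign_zero])
  have hex : ∀ r, ∃ r', (r ∈ Z₁ → r' = h r) ∧ (r ∉ Z₁ → P.eval r = 0 →
      Q.eval r' = 0 ∧ ∀ z ∈ Z₁, (z < r → h z < r') ∧ (r < z → r' < h z)) := by
    intro r
    by_cases hr : r ∈ Z₁
    · exact ⟨h r, fun _ => rfl, fun h1 => absurd hr h1⟩
    by_cases hr0 : P.eval r = 0
    · obtain ⟨r', h1⟩ := exists_root_in_gap hz₁ hZ₁' hr0 hr ⟨lo, hloZ, hloP r hr0⟩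
        ⟨hi, hhiZ, hhiP r hr0⟩
      exact ⟨r', fun h2 => absurd h2 hr, fun _ _ => h1⟩
    · exact ⟨0, fun h1 => absurd h1 hr, fun _ h1 => absurd h1 hr0⟩
  -- `w` is `h` on `Z₁` and sends the other zeros of `P` to their counterparts
  choose w hw₁ hw₂ using hex
  set Z' : Finset ℝ := Z₁ ∪ P.roots.toFinset with hZ'
  have hroot' : ∀ t, P.eval t = 0 → t ∈ Z' := fun t ht => by simp [hZ', hP, ht]
  have hmono : StrictMonoOn w Z' := by
    have hm : ∀ t ∈ Z', t ∉ Z₁ → P.eval t = 0 := by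
      intro t ht ht'
      have := (Finset.mem_union.1 ht).resolve_left ht'
      simpa [hP] using this
    intro r hr s hs hrs
    by_cases hr₁ : r ∈ Z₁ <;> by_cases hs₁ : s ∈ Z₁
    · rw [hw₁ r hr₁, hw₁ s hs₁]; exact h.strictMono hrs
    · rw [hw₁ r hr₁]; exact ((hw₂ s hs₁ (hm s hs hs₁)).2 r hr₁).1 hrs
    · rw [hw₁ s hs₁]; exact ((hw₂ r hr₁ (hm r hr hr₁)).2 s hs₁).2 hrs
    · obtain ⟨z, hzm, hz0⟩ := P.exists_derivative_eq_zero hrs (hm r hr hr₁) (hm s hs hs₁)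
      have hzZ := hZ₁' z hz0
      exact (((hw₂ r hr₁ (hm r hr hr₁)).2 z hzZ).2 hzm.1).trans
        (((hw₂ s hs₁ (hm s hs hs₁)).2 z hzZ).1 hzm.2)
  obtain ⟨h', hh'⟩ := exists_orderIso_eqOn Z' w hmono
  have hagree : ∀ z ∈ Z₁, h' z = h z := fun z hzm => by
    rw [hh' z (Finset.mem_union_left _ hzm), hw₁ z hzm]
  have hzero : ∀ t, P.eval t = 0 → Q.eval (h' t) = 0 := by
    intro t ht
    by_cases htZ : t ∈ Z₁
    · rw [hagree t htZ, ← sign_eq_zero_iff, ← hz₁ t htZ, ht, sign_zero]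
    · rw [hh' t (hroot' t ht)]; exact (hw₂ t htZ ht).1
  have hzero' : ∀ t, Q.eval (h' t) = 0 → P.eval t = 0 := by
    intro t ht
    by_cases htZ : t ∈ Z₁
    · rw [hagree t htZ] at ht
      rw [← sign_eq_zero_iff, hz₁ t htZ, ht, sign_zero]
    obtain ⟨y, hy⟩ := h.surjective (h' t)
    have hQy : Q.eval (h y) = 0 := by rw [hy, ht]
    have hmap : ∀ x, x ∈ Z₁.map h.toEquiv.toEmbedding ↔ h.symm x ∈ Z₁ := by
      intro x
      simp only [Finset.mem_map_equiv]
      rfl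
    obtain ⟨r, hr0, hr⟩ := exists_root_in_gap (P := Q) (Q := P) (h := h.symm)
      (Z := Z₁.map h.toEquiv.toEmbedding) (r := h' t)
      (fun z hzm => by
        rw [hz₁ _ ((hmap z).1 hzm), OrderIso.apply_symm_apply])
      (fun x hx => (hmap x).2 (hZQ _ (by rwa [OrderIso.apply_symm_apply]))) ht
      (fun hm => htZ (by
        have h1 := (hmap _).1 hm
        rw [← hy, OrderIso.symm_apply_apply] at h1
        rw [← hagree y h1] at hy
        rwa [← h'.injective hy]))
      ⟨h lo, (hmap _).2 (by simpa using hloZ), by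
        rw [← hy]; exact h.strictMono (hloQ y hQy)⟩
      ⟨h hi, (hmap _).2 (by simpa using hhiZ), by
        rw [← hy]; exact h.strictMono (hhiQ y hQy)⟩
    have hr' : ∀ z ∈ Z₁, (z < t → z < r) ∧ (t < z → r < z) := by
      intro z hzm
      have h1 := hr (h z) ((hmap _).2 (by simpa using hzm))
      rw [OrderIso.symm_apply_apply] at h1
      refine ⟨fun h2 => h1.1 ?_, fun h2 => h1.2 ?_⟩
      · rw [← hagree z hzm]; exact h'.strictMono h2
      · rw [← hagree z hzm]; exact h'.strictMono h2
    -- a zero of `Q'` strictly between `h' t` and `h' r` would separate `t` and `r`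
    have hbetween : ∀ a b, a < b → Q.eval (h' a) = 0 → Q.eval (h' b) = 0 →
        ∃ z ∈ Z₁, a < z ∧ z < b := by
      intro a b hab ha hb
      obtain ⟨v, hv, hv0⟩ := Q.exists_derivative_eq_zero (h'.strictMono hab) ha hb
      obtain ⟨z, rfl⟩ := h.surjective v
      have hzm := hZQ z hv0
      rw [← hagree z hzm] at hv
      exact ⟨z, hzm, h'.lt_iff_lt.1 hv.1, h'.lt_iff_lt.1 hv.2⟩
    rcases lt_trichotomy t r with h1 | h1 | h1
    · obtain ⟨z, hzm, h2, h3⟩ := hbetween t r h1 ht (hzero r hr0)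
      exact absurd ((hr' z hzm).2 h2) (not_lt.2 h3.le)
    · rwa [h1]
    · obtain ⟨z, hzm, h2, h3⟩ := hbetween r t h1 (hzero r hr0) ht
      exact absurd ((hr' z hzm).1 h3) (not_lt.2 h2.le)
  refine ⟨h', fun z hzm => hagree z (by simp [hZ₁, hzm]), fun t => ?_⟩
  by_cases ht₁ : t ∈ Z₁
  · rw [hagree t ht₁, hz₁ t ht₁]
  by_cases ht0 : P.eval t = 0
  · rw [ht0, hzero t ht0]
  -- With `u` the largest point of `Z'` below `t`, the sign of `P` at `t` is its sign at `u`, or the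
  -- sign of `P'` at `t` if `P` vanishes at `u`; the same holds for `Q` at `h' u` and `h' t`.
  by_cases hpred : ∃ u ∈ Z', u < t
  · obtain ⟨u, hu, humax⟩ := (Z'.filter (· < t)).exists_max_image id
      (by obtain ⟨z, h1, h2⟩ := hpred; exact ⟨z, by simp [h1, h2]⟩)
    simp only [Finset.mem_filter, id] at hu humax
    have hgap : ∀ z ∈ Z', u < z → z ≤ t → z = t := fun z hzm h1 h2 => by
      by_contra h3
      exact absurd (humax z ⟨hzm, lt_of_le_of_ne h2 h3⟩) (not_le.2 h1)
    by_cases hu0 : P.eval u = 0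
    · have hd1 : ∀ z, u < z → z ≤ t → P.derivative.eval z ≠ 0 := by
        intro z h1 h2 h3
        have h4 := hZ₁' z h3
        exact ht₁ (hgap z (Finset.mem_union_left _ h4) h1 h2 ▸ h4)
      have hd2 : ∀ z, h' u < z → z ≤ h' t → Q.derivative.eval z ≠ 0 := by
        intro z h1 h2 h3
        obtain ⟨y, rfl⟩ := h.surjective z
        have h4 := hZQ y h3
        rw [← hagree y h4] at h1 h2
        exact ht₁ (hgap y (Finset.mem_union_left _ h4) (h'.lt_iff_lt.1 h1)
          (h'.le_iff_le.1 h2) ▸ h4)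
      have h1 := P.sign_eval_sub_eval hu.2 (Set.right_mem_Icc.2 hu.2.le)
        (fun x hx => hd1 x hx.1 hx.2.le) (hd1 t hu.2 le_rfl)
      have hu' : h' u < h' t := h'.strictMono hu.2
      have h2 := Q.sign_eval_sub_eval hu' (Set.right_mem_Icc.2 hu'.le)
        (fun x hx => hd2 x hx.1 hx.2.le) (hd2 _ hu' le_rfl)
      rw [hu0, sub_zero] at h1
      rw [hzero u hu0, sub_zero] at h2
      rw [h1, h2]
      exact sign_match_of_agree hagree hd hZ₁' t
    · have hu₁ : u ∈ Z₁ := by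
        by_contra h1
        have := (Finset.mem_union.1 hu.1).resolve_left h1
        simp only [Multiset.mem_toFinset, mem_roots', IsRoot.def] at this
        exact hu0 this.2
      have hP1 : ∀ z, u ≤ z → z ≤ t → P.eval z ≠ 0 := by
        intro z h1 h2 h3
        rcases h1.eq_or_lt with rfl | h1
        · exact hu0 h3
        · exact ht0 (hgap z (hroot' z h3) h1 h2 ▸ h3)
      have h1 : SignType.sign (P.eval u) = SignType.sign (P.eval t) := by
        apply sign_eval_eq_of_ne_zero
        intro z hzm
        rw [Set.uIcc_of_le hu.2.le] at hzm
        exact hP1 z hzm.1 hzm.2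
      have h2 : SignType.sign (Q.eval (h' u)) = SignType.sign (Q.eval (h' t)) := by
        apply sign_eval_eq_of_ne_zero
        intro z hzm hz0
        rw [Set.uIcc_of_le (h'.monotone hu.2.le)] at hzm
        obtain ⟨y, rfl⟩ := h'.surjective z
        exact hP1 y (h'.le_iff_le.1 hzm.1) (h'.le_iff_le.1 hzm.2) (hzero' y hz0)
      rw [← h1, ← h2, hagree u hu₁, hz₁ u hu₁]
  · push Not at hpred
    have htlo : t ≤ lo := hpred lo (Finset.mem_union_left _ hloZ)
    have h1 : SignType.sign (P.eval t) = SignType.sign (P.eval lo) := by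
      apply sign_eval_eq_of_ne_zero
      intro z hzm hz0
      rw [Set.uIcc_of_le htlo] at hzm
      exact absurd (hloP z hz0) (not_lt.2 hzm.2)
    have h2 : SignType.sign (Q.eval (h' t)) = SignType.sign (Q.eval (h' lo)) := by
      apply sign_eval_eq_of_ne_zero
      intro z hzm hz0
      rw [Set.uIcc_of_le (h'.monotone htlo)] at hzm
      obtain ⟨y, rfl⟩ := h'.surjective z
      exact absurd (hloP y (hzero' y hz0)) (not_lt.2 (h'.le_iff_le.1 hzm.2))
    rw [h1, h2, hagree lo hloZ, hz₁ lo hloZ]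

/-! ### Sign diagrams that depend on parameters -/

open Polynomial in
/-- One cancellation step of the division of `P` by `g`, scaled by the square of a coefficient of
`g` so that signs are kept. -/
lemma Polynomial.natDegree_cancel_lt {A : Type*} [CommRing A] {P g : A[X]} {e : ℕ}
    (hP : P.natDegree ≠ 0) (hg : g.natDegree ≤ e) (he : e ≤ P.natDegree) :
    (C (g.coeff e ^ 2) * P - C (g.coeff e * P.leadingCoeff) * X ^ (P.natDegree - e) * g).natDegree
      < P.natDegree := by
  set r := C (g.coeff e ^ 2) * P - C (g.coeff e * P.leadingCoeff) * X ^ (P.natDegree - e) * g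
    with hr
  have h1 : r.natDegree ≤ P.natDegree := by
    refine (natDegree_sub_le _ _).trans (max_le (natDegree_C_mul_le _ _) ?_)
    refine natDegree_mul_le.trans ?_
    have := natDegree_C_mul_X_pow_le (g.coeff e * P.leadingCoeff) (P.natDegree - e)
    omega
  have h2 : r.coeff P.natDegree = 0 := by
    have h3 : (C (g.coeff e * P.leadingCoeff) * X ^ (P.natDegree - e) * g).coeff P.natDegree =
        g.coeff e * P.leadingCoeff * g.coeff e := by
      rw [mul_assoc, coeff_C_mul, coeff_X_pow_mul', if_pos (Nat.sub_le _ _),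
        Nat.sub_sub_self he]
    rw [hr, coeff_sub, h3, coeff_C_mul, coeff_natDegree]
    ring
  refine lt_of_le_of_ne h1 fun h3 => ?_
  rw [← h3] at h2
  have h4 : r = 0 := leadingCoeff_eq_zero.1 h2
  rw [h4, natDegree_zero] at h3
  exact hP h3.symm

open Polynomial in
lemma Polynomial.sign_eval_cancel {P r g : ℝ[X]} {c b : ℝ} {k : ℕ} (hc : c ≠ 0)
    (hr : r = C (c ^ 2) * P - C b * X ^ k * g) {t : ℝ} (ht : g.eval t = 0) :
    SignType.sign (P.eval t) = SignType.sign (r.eval t) := by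
  have h0 : 0 < c ^ 2 := by positivity
  simp [hr, ht, sign_mul, sign_pos h0]

open Polynomial in
/-- Quantifier elimination over a ring `A` of coefficients that is evaluated at the points of `Ω`:
the signs of finitely many elements of `A` at a point `x` determine, up to an order automorphism of
the line, the sign diagram of finitely many polynomials with coefficients evaluated at `x`.

The proof is the reduction of Cohen and Hörmander. A polynomial `P` of highest degree is replaced
by its derivative and by the results of one division step by the other polynomials; if some
leading coefficient vanishes at `x`, it is erased instead. Both steps make the multiset of degrees
smaller in the Dershowitz–Manna order. -/
theorem Polynomial.exists_finite_sign_determining {Ω A : Type*} [CommRing A] (ev : Ω → A →+* ℝ)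
    (F : Multiset A[X]) :
    ∃ G : Set A, G.Finite ∧ ∀ x y : Ω,
      (∀ a ∈ G, SignType.sign (ev x a) = SignType.sign (ev y a)) →
      ∃ h : ℝ ≃o ℝ, ∀ f ∈ F, ∀ t, SignType.sign ((f.map (ev x)).eval t) =
        SignType.sign ((f.map (ev y)).eval (h t)) := by
  classical
  induction F using (InvImage.wf (fun F : Multiset A[X] => F.map natDegree)
    Multiset.wellFounded_isDershowitzMannaLT).induction with
  | h F ih =>
  simp only [InvImage] at ih
  by_cases hconst : ∃ f ∈ F, f.natDegree = 0
  · obtain ⟨f, hf, hf0⟩ := hconst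
    obtain ⟨F₀, rfl⟩ := Multiset.exists_cons_of_mem hf
    obtain ⟨G, hG, hGF⟩ := ih F₀ ⟨F₀.map natDegree, 0, {f.natDegree}, by simp, by simp,
      by simp [← Multiset.singleton_add, add_comm], by simp⟩
    refine ⟨insert (f.coeff 0) G, hG.insert _, fun x y hxy => ?_⟩
    obtain ⟨h, hh⟩ := hGF x y fun a ha => hxy a (Set.mem_insert_of_mem _ ha)
    refine ⟨h, fun g hg t => ?_⟩
    rcases Multiset.mem_cons.1 hg with rfl | hg
    · rw [eq_C_of_natDegree_eq_zero hf0]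
      simpa using hxy _ (Set.mem_insert _ _)
    · exact hh g hg t
  push Not at hconst
  rcases F.empty_or_exists_mem with rfl | ⟨f₀, hf₀⟩
  · exact ⟨∅, Set.finite_empty, fun x y _ => ⟨OrderIso.refl ℝ, by simp⟩⟩
  obtain ⟨P, hPF, hPmax⟩ := F.toFinset.exists_max_image natDegree ⟨f₀, by simpa using hf₀⟩
  simp only [Multiset.mem_toFinset] at hPF hPmax
  have hPdeg := hconst P hPF
  obtain ⟨F₀, hF₀⟩ := Multiset.exists_cons_of_mem hPF
  -- the result of one division step of `P` by `g`
  let r : ℕ → A[X] → A[X] := fun e g =>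
    C (g.coeff e ^ 2) * P - C (g.coeff e * P.leadingCoeff) * X ^ (P.natDegree - e) * g
  have hder : P.derivative.natDegree < P.natDegree := natDegree_derivative_lt hPdeg
  let R := P.derivative ::ₘ r (P.natDegree - 1) P.derivative ::ₘ F₀.map fun g => r g.natDegree g
  obtain ⟨G₁, hG₁, hG₁F⟩ := ih (F₀ + R) ⟨F₀.map natDegree, R.map natDegree, {P.natDegree}, by simp,
    by simp, by simp [hF₀, ← Multiset.singleton_add, add_comm], by
      intro d hd
      refine ⟨P.natDegree, by simp, ?_⟩
      simp only [R, Multiset.map_cons, Multiset.mem_cons, Multiset.map_map, Multiset.mem_map,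
        Function.comp] at hd
      rcases hd with rfl | rfl | ⟨g, hg, rfl⟩
      · exact hder
      · exact natDegree_cancel_lt hPdeg (by omega) (by omega)
      · exact natDegree_cancel_lt hPdeg le_rfl (hPmax g (by simp [hF₀, hg]))⟩
  have herase : ∀ f : A[X], ∃ G : Set A, G.Finite ∧ (f ∈ F → ∀ x y : Ω,
      (∀ a ∈ G, SignType.sign (ev x a) = SignType.sign (ev y a)) →
      ∃ h : ℝ ≃o ℝ, ∀ g ∈ f.eraseLead ::ₘ F.erase f, ∀ t,
        SignType.sign ((g.map (ev x)).eval t) = SignType.sign ((g.map (ev y)).eval (h t))) := by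
    intro f
    by_cases hf : f ∈ F
    · obtain ⟨G, hG, hGF⟩ := ih (f.eraseLead ::ₘ F.erase f)
        ⟨(F.erase f).map natDegree, {f.eraseLead.natDegree}, {f.natDegree}, by simp,
        by simp [← Multiset.singleton_add, add_comm], by
          conv_lhs => rw [← Multiset.cons_erase hf]
          simp [← Multiset.singleton_add, add_comm], by
          have h1 := f.eraseLead_natDegree_le
          have h2 := hconst f hf
          simp only [Multiset.mem_singleton, forall_eq, exists_eq_left]
          omega⟩
      exact ⟨G, hG, fun _ => hGF⟩
    · exact ⟨∅, Set.finite_empty, fun h => absurd h hf⟩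
  choose G₂ hG₂ hG₂F using herase
  refine ⟨G₁ ∪ (⋃ f ∈ {f | f ∈ F}, G₂ f) ∪ leadingCoeff '' {f | f ∈ F},
    (hG₁.union (F.finite_toSet.biUnion fun f _ => hG₂ f)).union (F.finite_toSet.image _),
    fun x y hxy => ?_⟩
  have hlead : ∀ f ∈ F, SignType.sign (ev x f.leadingCoeff) = SignType.sign (ev y f.leadingCoeff) :=
    fun f hf => hxy _ (Or.inr ⟨f, hf, rfl⟩)
  by_cases hvan : ∃ f ∈ F, ev x f.leadingCoeff = 0
  · obtain ⟨f, hf, hfx⟩ := hvan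
    have hfy : ev y f.leadingCoeff = 0 := by
      rw [← sign_eq_zero_iff, ← hlead f hf, hfx, sign_zero]
    obtain ⟨h, hh⟩ := hG₂F f hf x y fun a ha =>
      hxy a (Or.inl (Or.inr (Set.mem_biUnion (show f ∈ {f | f ∈ F} from hf) ha)))
    refine ⟨h, fun g hg t => ?_⟩
    by_cases hgf : g = f
    · subst hgf
      have hm : ∀ z : Ω, ev z g.leadingCoeff = 0 → g.map (ev z) = g.eraseLead.map (ev z) := by
        intro z hz
        conv_lhs => rw [← g.eraseLead_add_C_mul_X_pow, Polynomial.map_add, Polynomial.map_mul,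
          map_C, hz, C_0, zero_mul, add_zero]
      rw [hm x hfx, hm y hfy]
      exact hh _ (Multiset.mem_cons_self _ _) t
    · exact hh g (Multiset.mem_cons_of_mem ((Multiset.mem_erase_of_ne hgf).2 hg)) t
  push Not at hvan
  obtain ⟨h, hh⟩ := hG₁F x y fun a ha => hxy a (Or.inl (Or.inl ha))
  have hvany : ∀ f ∈ F, ev y f.leadingCoeff ≠ 0 := fun f hf h0 =>
    hvan f hf (by rw [← sign_eq_zero_iff, hlead f hf, h0, sign_zero])
  have hne : ∀ z : Ω, (∀ f ∈ F, ev z f.leadingCoeff ≠ 0) → ∀ f ∈ F, f.map (ev z) ≠ 0 := by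
    intro z hz f hf h0
    apply hz f hf
    rw [leadingCoeff, ← coeff_map, h0, coeff_zero]
  have hdercoeff : ∀ z : Ω, ev z P.leadingCoeff ≠ 0 →
      ev z (P.derivative.coeff (P.natDegree - 1)) ≠ 0 := by
    intro z hz
    rw [coeff_derivative, Nat.sub_add_cancel (Nat.pos_of_ne_zero hPdeg), coeff_natDegree, map_mul]
    refine mul_ne_zero hz ?_
    have h1 : ((P.natDegree - 1 : ℕ) : A) + 1 = (P.natDegree : A) := by
      rw [← Nat.cast_succ, Nat.succ_eq_add_one, Nat.sub_add_cancel (Nat.pos_of_ne_zero hPdeg)]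
    rw [h1, map_natCast]
    exact_mod_cast hPdeg
  have hPx := hne x hvan P hPF
  have hPder : P.derivative.map (ev x) ≠ 0 := fun h0 => hdercoeff x (hvan P hPF) (by
    rw [← coeff_map, h0, coeff_zero])
  -- the zeros of the polynomials other than `P`, and of `P'`
  let Z : Finset ℝ := (F₀.toFinset.biUnion fun g => (g.map (ev x)).roots.toFinset) ∪
    (P.derivative.map (ev x)).roots.toFinset
  have hmemR : ∀ g ∈ R, ∀ t, SignType.sign ((g.map (ev x)).eval t) =
      SignType.sign ((g.map (ev y)).eval (h t)) := fun g hg =>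
    hh g (Multiset.mem_add.2 (Or.inr hg))
  have hmemF₀ : ∀ g ∈ F₀, ∀ t, SignType.sign ((g.map (ev x)).eval t) =
      SignType.sign ((g.map (ev y)).eval (h t)) := fun g hg =>
    hh g (Multiset.mem_add.2 (Or.inl hg))
  have hF₀F : ∀ g ∈ F₀, g ∈ F := fun g hg => by simp [hF₀, hg]
  have hcancel : ∀ (z : Ω) (e : ℕ) (g : A[X]) (t : ℝ), ev z (g.coeff e) ≠ 0 →
      (g.map (ev z)).eval t = 0 → SignType.sign ((P.map (ev z)).eval t) =
        SignType.sign (((r e g).map (ev z)).eval t) := by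
    intro z e g t hc ht
    exact sign_eval_cancel hc (b := ev z (g.coeff e * P.leadingCoeff))
      (k := P.natDegree - e) (by simp [r]) ht
  have hkey : ∀ (e : ℕ) (g : A[X]) (t : ℝ), ev x (g.coeff e) ≠ 0 → ev y (g.coeff e) ≠ 0 →
      (∀ t, SignType.sign ((g.map (ev x)).eval t) = SignType.sign ((g.map (ev y)).eval (h t))) →
      r e g ∈ R → (g.map (ev x)).eval t = 0 →
      SignType.sign ((P.map (ev x)).eval t) = SignType.sign ((P.map (ev y)).eval (h t)) := by
    intro e g t hcx hcy hg hr ht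
    have ht' : (g.map (ev y)).eval (h t) = 0 := by
      rw [← sign_eq_zero_iff, ← hg t, ht, sign_zero]
    rw [hcancel x e g t hcx ht, hcancel y e g _ hcy ht', hmemR _ hr]
  obtain ⟨h', hagree, hP'⟩ := exists_orderIso_sign_match (P := P.map (ev x)) (Q := P.map (ev y))
    (h := h) (Z := Z) hPx (hne y hvany P hPF)
    (by rw [natDegree_map_of_leadingCoeff_ne_zero _ (hvan P hPF),
      natDegree_map_of_leadingCoeff_ne_zero _ (hvany P hPF)])
    (by rw [leadingCoeff_map_of_leadingCoeff_ne_zero _ (hvan P hPF),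
      leadingCoeff_map_of_leadingCoeff_ne_zero _ (hvany P hPF), hlead P hPF])
    (fun t => by
      rw [derivative_map, derivative_map]
      exact hmemR P.derivative (by simp [R]) t)
    (fun t ht => by
      simp only [Z, Finset.mem_union, Finset.mem_biUnion, Multiset.mem_toFinset, mem_roots',
        IsRoot.def] at ht
      rcases ht with ⟨g, hg, -, ht⟩ | ⟨-, ht⟩
      · exact hkey g.natDegree g t (hvan g (hF₀F g hg)) (hvany g (hF₀F g hg)) (hmemF₀ g hg)
          (by simp only [R, Multiset.mem_cons, Multiset.mem_map]; exact Or.inr (Or.inr ⟨g, hg, rfl⟩))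
          ht
      · exact hkey (P.natDegree - 1) P.derivative t (hdercoeff x (hvan P hPF))
          (hdercoeff y (hvany P hPF)) (hmemR _ (by simp [R])) (by simp [R]) ht)
    (fun t ht => by
      rw [derivative_map] at ht
      simp [Z, hPder, ht])
  refine ⟨h', fun g hg => ?_⟩
  rw [hF₀] at hg
  rcases Multiset.mem_cons.1 hg with rfl | hg
  · exact hP'
  · refine sign_match_of_agree hagree (hmemF₀ g hg) fun t ht => ?_
    simp only [Z, Finset.mem_union, Finset.mem_biUnion, Multiset.mem_toFinset, mem_roots',
      IsRoot.def]
    exact Or.inl ⟨g, hg, hne x hvan g (hF₀F g hg), ht⟩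

/-! ### The Tarski–Seidenberg theorem -/

/-- A class of predicates on tuples that is closed under reindexing and under the quantifier `∃`
over one entry is closed under `∃` over a finite family of entries. The predicates may depend on a
parameter from `δ`. -/
lemma exists_family_of_exists {δ X : Type*} (Cl : ∀ ι : Type, (δ → (ι → X) → Prop) → Prop)
    (hre : ∀ (ι κ : Type) (e : ι → κ) (P : δ → (ι → X) → Prop), Cl ι P →
      Cl κ (fun d x => P d (x ∘ e)))
    (hex : ∀ (ι : Type) (P : δ → (Option ι → X) → Prop), Cl (Option ι) P →
      Cl ι (fun d x => ∃ a, P d (fun o => o.elim a x)))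
    (κ : Type) [Finite κ] : ∀ (ι : Type) (P : δ → (ι ⊕ κ → X) → Prop), Cl (ι ⊕ κ) P →
      Cl ι (fun d x => ∃ z : κ → X, P d (Sum.elim x z)) := by
  induction κ using Finite.induction_empty_option with
  | of_equiv e ih =>
    rename_i κ κ'
    intro ι P hP
    have := ih ι _ (hre _ _ (Sum.map id e.symm) P hP)
    convert this using 3 with d x
    rw [(e.arrowCongr (Equiv.refl X)).symm.exists_congr_left]
    refine exists_congr fun z => ?_
    simp only [Equiv.symm_symm, Sum.elim_comp_map, Function.comp_id]
    rfl
  | h_empty =>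
    intro ι P hP
    have := hre _ _ (Sum.elim id PEmpty.elim) P hP
    convert this using 3 with d x
    refine ⟨fun ⟨z, hz⟩ => ?_, fun hz => ⟨PEmpty.elim, ?_⟩⟩
    · convert hz using 1
      ext i; rcases i with i | i
      · rfl
      · exact i.elim
    · convert hz using 1
      ext i; rcases i with i | i
      · rfl
      · exact i.elim
  | h_option ih =>
    rename_i κ _
    intro ι P hP
    have h1 := hre _ (Option (ι ⊕ κ)) (Sum.elim (fun i => some (Sum.inl i))
      (fun o => o.elim none fun k => some (Sum.inr k))) P hP
    have h2 := ih ι _ (hex _ _ h1)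
    convert h2 using 3 with d x
    constructor
    · rintro ⟨z, hz⟩
      refine ⟨fun k => z (some k), z none, ?_⟩
      convert hz using 1
      ext i; rcases i with i | _ | i <;> rfl
    · rintro ⟨z, a, hz⟩
      refine ⟨fun o => o.elim a z, ?_⟩
      convert hz using 1
      ext i; rcases i with i | _ | i <;> rfl

namespace IsSemialgebraic

variable {ι κ : Type}

lemma univ : IsSemialgebraic (Set.univ : Set (ι → ℝ)) := by
  convert IsSemialgebraic.pos (1 : MvPolynomial ι ℤ) using 1
  ext x; simp

lemma empty : IsSemialgebraic (∅ : Set (ι → ℝ)) := by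
  simpa using (univ (ι := ι)).compl

lemma le (p q : MvPolynomial ι ℤ) :
    IsSemialgebraic {x : ι → ℝ | MvPolynomial.aeval x p ≤ MvPolynomial.aeval x q} := by
  convert (IsSemialgebraic.pos (p - q)).compl using 1
  ext x; simp

lemma eq (p q : MvPolynomial ι ℤ) :
    IsSemialgebraic {x : ι → ℝ | MvPolynomial.aeval x p = MvPolynomial.aeval x q} := by
  convert (le p q).inter (le q p) using 1
  ext x; exact le_antisymm_iff

lemma setOf_forall [Finite κ] {P : κ → (ι → ℝ) → Prop} (h : ∀ k, IsSemialgebraic {x | P k x}) :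
    IsSemialgebraic {x | ∀ k, P k x} := by
  suffices ∀ s : Set κ, s.Finite → IsSemialgebraic {x | ∀ k ∈ s, P k x} by
    simpa using this Set.univ Set.finite_univ
  intro s hs
  induction s, hs using Set.Finite.induction_on with
  | empty => simpa using univ
  | @insert k _ _ _ ih =>
    convert (h k).inter ih using 1
    ext x; simp

lemma preimage {S : Set (κ → ℝ)} (hS : IsSemialgebraic S) (t : κ → MvPolynomial ι ℤ) :
    IsSemialgebraic {x : ι → ℝ | (fun k => MvPolynomial.aeval x (t k)) ∈ S} := by
  induction hS with
  | pos p =>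
    convert IsSemialgebraic.pos (MvPolynomial.bind₁ t p) using 1
    ext x
    simp [MvPolynomial.aeval_bind₁]
  | compl _ ih => exact ih.compl
  | inter _ _ ih₁ ih₂ => exact ih₁.inter ih₂
  | union _ _ ih₁ ih₂ => exact ih₁.union ih₂

lemma reindex {S : Set (κ → ℝ)} (hS : IsSemialgebraic S) (e : κ → ι) :
    IsSemialgebraic {x : ι → ℝ | x ∘ e ∈ S} := by
  convert hS.preimage (fun k => MvPolynomial.X (e k)) using 1
  ext x; simp [Function.comp_def]

/-- Membership in a semialgebraic set is determined by the signs of finitely many polynomials. -/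
lemma exists_finite_sign_determining {S : Set (ι → ℝ)} (hS : IsSemialgebraic S) :
    ∃ F : Finset (MvPolynomial ι ℤ), ∀ x y : ι → ℝ,
      (∀ p ∈ F, SignType.sign (MvPolynomial.aeval x p : ℝ) =
        SignType.sign (MvPolynomial.aeval y p : ℝ)) → (x ∈ S ↔ y ∈ S) := by
  classical
  induction hS with
  | pos p =>
    refine ⟨{p}, fun x y h => ?_⟩
    have := h p (by simp)
    rw [Set.mem_ofPred_eq, Set.mem_ofPred_eq, ← sign_eq_one_iff, this, sign_eq_one_iff]
  | compl _ ih =>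
    obtain ⟨F, hF⟩ := ih
    exact ⟨F, fun x y h => not_congr (hF x y h)⟩
  | inter _ _ ih₁ ih₂ =>
    obtain ⟨F₁, hF₁⟩ := ih₁
    obtain ⟨F₂, hF₂⟩ := ih₂
    exact ⟨F₁ ∪ F₂, fun x y h => and_congr (hF₁ x y fun p hp => h p (by simp [hp]))
      (hF₂ x y fun p hp => h p (by simp [hp]))⟩
  | union _ _ ih₁ ih₂ =>
    obtain ⟨F₁, hF₁⟩ := ih₁
    obtain ⟨F₂, hF₂⟩ := ih₂
    exact ⟨F₁ ∪ F₂, fun x y h => or_congr (hF₁ x y fun p hp => h p (by simp [hp]))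
      (hF₂ x y fun p hp => h p (by simp [hp]))⟩

/-- A set that is a union of sign classes of finitely many polynomials is semialgebraic. -/
lemma of_sign_invariant {G : Set (MvPolynomial ι ℤ)} (hG : G.Finite) : ∀ T : Set (ι → ℝ),
    (∀ x y : ι → ℝ, (∀ p ∈ G, SignType.sign (MvPolynomial.aeval x p : ℝ) =
      SignType.sign (MvPolynomial.aeval y p : ℝ)) → x ∈ T → y ∈ T) → IsSemialgebraic T := by
  induction G, hG using Set.Finite.induction_on with
  | empty =>
    intro T hT
    rcases T.eq_empty_or_nonempty with rfl | ⟨x, hx⟩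
    · exact empty
    · rw [Set.eq_univ_of_forall fun y => hT x y (by simp) hx]
      exact univ
  | @insert a G _ _ ih =>
    intro T hT
    have hsgn : ∀ s : SignType,
        IsSemialgebraic {x : ι → ℝ | SignType.sign (MvPolynomial.aeval x a : ℝ) = s} := by
      intro s
      cases s
      · convert eq a 0 using 1
        ext x; simp
      · convert IsSemialgebraic.pos (-a) using 1
        ext x; simp [sign_eq_neg_one_iff]
      · convert IsSemialgebraic.pos a using 1
        ext x; simp [sign_eq_one_iff]
    let U : SignType → Set (ι → ℝ) := fun s => {x | ∃ y ∈ T,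
      SignType.sign (MvPolynomial.aeval y a : ℝ) = s ∧ ∀ p ∈ G,
        SignType.sign (MvPolynomial.aeval y p : ℝ) = SignType.sign (MvPolynomial.aeval x p : ℝ)}
    have hU : ∀ s, IsSemialgebraic (U s) := fun s => ih _ (by
      rintro x y hxy ⟨z, hz, hza, hzp⟩
      exact ⟨z, hz, hza, fun p hp => (hzp p hp).trans (hxy p hp)⟩)
    have hall : IsSemialgebraic {x | ∀ s : SignType,
        ¬ (x ∈ U s ∧ SignType.sign (MvPolynomial.aeval x a : ℝ) = s)} :=
      setOf_forall fun s => ((hU s).inter (hsgn s)).compl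
    convert hall.compl using 1
    ext x
    simp only [Set.mem_compl_iff, Set.mem_ofPred_eq, not_forall, not_not]
    constructor
    · exact fun hx => ⟨_, ⟨x, hx, rfl, fun _ _ => rfl⟩, rfl⟩
    · rintro ⟨s, ⟨y, hy, hya, hyp⟩, hs⟩
      refine hT y x (fun p hp => ?_) hy
      rcases hp with rfl | hp
      · rw [hya, hs]
      · exact hyp p hp

lemma _root_.MvPolynomial.aeval_option_elim (x : ι → ℝ) (a : ℝ) (p : MvPolynomial (Option ι) ℤ) :
    MvPolynomial.aeval (fun o => o.elim a x) p = ((MvPolynomial.optionEquivLeft ℤ ι p).map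
      (MvPolynomial.aeval (R := ℤ) x : MvPolynomial ι ℤ →ₐ[ℤ] ℝ).toRingHom).eval a := by
  induction p using MvPolynomial.induction_on with
  | C r => simp
  | add p q hp hq => simp [hp, hq]
  | mul_X p o hp => cases o <;> simp [hp]

/-- Semialgebraic sets are closed under projection (Tarski–Seidenberg). -/
theorem exists_option {S : Set (Option ι → ℝ)} (hS : IsSemialgebraic S) :
    IsSemialgebraic {x : ι → ℝ | ∃ a : ℝ, (fun o : Option ι => o.elim a x) ∈ S} := by
  obtain ⟨F, hF⟩ := hS.exists_finite_sign_determining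
  obtain ⟨G, hG, hGF⟩ := Polynomial.exists_finite_sign_determining
    (fun x : ι → ℝ => (MvPolynomial.aeval (R := ℤ) x : MvPolynomial ι ℤ →ₐ[ℤ] ℝ).toRingHom)
    (F.val.map (MvPolynomial.optionEquivLeft ℤ ι))
  refine of_sign_invariant hG _ ?_
  rintro x y hxy ⟨a, ha⟩
  obtain ⟨h, hh⟩ := hGF x y hxy
  refine ⟨h a, (hF _ _ fun p hp => ?_).1 ha⟩
  rw [MvPolynomial.aeval_option_elim, MvPolynomial.aeval_option_elim]
  exact hh _ (Multiset.mem_map_of_mem _ hp) a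

theorem exists_family [Finite κ] {S : Set (ι ⊕ κ → ℝ)} (hS : IsSemialgebraic S) :
    IsSemialgebraic {x : ι → ℝ | ∃ z : κ → ℝ, Sum.elim x z ∈ S} :=
  exists_family_of_exists (δ := Unit) (fun _ P => IsSemialgebraic {x | P () x})
    (fun _ _ e _ h => h.reindex e) (fun _ _ h => h.exists_option) κ ι (fun _ x => x ∈ S) hS

end IsSemialgebraic

/-! ### Triangle formulas in real coordinates -/

lemma Triangle.mem_drawing_iff {T : Triangle} {p : PlanePoint} :
    p ∈ T.drawing ↔ ∃ w : Fin 3 → ℝ, (∀ i, 0 ≤ w i) ∧ ∑ i, w i = 1 ∧ ∑ i, w i • T i = p := by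
  constructor
  · intro hp
    let f : (Fin 3 → ℝ) →ₗ[ℝ] PlanePoint := Fintype.linearCombination ℝ T
    have h1 : T.drawing ⊆ f '' stdSimplex ℝ (Fin 3) := by
      refine convexHull_min ?_ ((convex_stdSimplex ℝ (Fin 3)).linear_image f)
      rintro _ ⟨i, rfl⟩
      exact ⟨Pi.single i 1, single_mem_stdSimplex ℝ i, by
        simp [f, Fintype.linearCombination_apply_single]⟩
    obtain ⟨w, ⟨hw0, hw1⟩, hw⟩ := h1 hp
    exact ⟨w, hw0, hw1, by rw [← hw, Fintype.linearCombination_apply]⟩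
  · rintro ⟨w, hw0, hw1, rfl⟩
    exact mem_convexHull_of_exists_fintype w T hw0 hw1 (fun i => Set.mem_range_self i) rfl

lemma Triangle.corner_mem_drawing (T : Triangle) (i : Fin 3) : T i ∈ T.drawing :=
  subset_convexHull ℝ _ (Set.mem_range_self i)

lemma Triangle.partOf_iff {T₁ T₂ : Triangle} : T₁.PartOf T₂ ↔ ∀ j, T₁ j ∈ T₂.drawing := by
  constructor
  · exact fun h j => h (T₁.corner_mem_drawing j)
  · intro h
    refine convexHull_min ?_ (convex_convexHull ℝ _)
    rintro _ ⟨j, rfl⟩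
    exact h j

lemma Triangle.triEq_iff {T₁ T₂ : Triangle} : T₁.TriEq T₂ ↔ T₁.drawing = T₂.drawing :=
  Set.Subset.antisymm_iff.symm

lemma Triangle.isSemialgebraic_partOf :
    IsSemialgebraic {x : CoordIndex 2 → ℝ |
      Triangle.PartOf ((canonicalBijection 2).symm x 0) ((canonicalBijection 2).symm x 1)} := by
  have key : ∀ j : Fin 3, IsSemialgebraic {x : CoordIndex 2 → ℝ | ∃ w : Fin 3 → ℝ,
      Sum.elim x w ∈ {z : CoordIndex 2 ⊕ Fin 3 → ℝ | (∀ i, 0 ≤ z (Sum.inr i)) ∧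
        ∑ i, z (Sum.inr i) = 1 ∧
        ∀ l, ∑ i, z (Sum.inr i) * z (Sum.inl (1, i, l)) = z (Sum.inl (0, j, l))}} := by
    intro j
    have h₁ : ∀ i, IsSemialgebraic {z : CoordIndex 2 ⊕ Fin 3 → ℝ | 0 ≤ z (Sum.inr i)} := by
      intro i
      convert IsSemialgebraic.le 0 (MvPolynomial.X (Sum.inr i)) using 1
      ext z; simp
    have h₂ : IsSemialgebraic {z : CoordIndex 2 ⊕ Fin 3 → ℝ | ∑ i, z (Sum.inr i) = 1} := by
      convert IsSemialgebraic.eq (∑ i : Fin 3, MvPolynomial.X (Sum.inr i)) 1 using 1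
      ext z; simp
    have h₃ : ∀ l, IsSemialgebraic {z : CoordIndex 2 ⊕ Fin 3 → ℝ |
        ∑ i, z (Sum.inr i) * z (Sum.inl (1, i, l)) = z (Sum.inl (0, j, l))} := by
      intro l
      convert IsSemialgebraic.eq (ι := CoordIndex 2 ⊕ Fin 3)
        (∑ i : Fin 3, MvPolynomial.X (Sum.inr i) * MvPolynomial.X (Sum.inl (1, i, l)))
        (MvPolynomial.X (Sum.inl (0, j, l))) using 1
      ext z; simp
    exact ((IsSemialgebraic.setOf_forall h₁).inter
      (h₂.inter (IsSemialgebraic.setOf_forall h₃))).exists_family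
  convert IsSemialgebraic.setOf_forall key using 1
  ext x
  simp only [Triangle.partOf_iff, Triangle.mem_drawing_iff, Set.mem_ofPred_eq, Sum.elim_inl,
    Sum.elim_inr]
  refine forall_congr' fun j => exists_congr fun w => and_congr_right fun _ =>
    and_congr_right fun _ => ?_
  rw [funext_iff]
  refine forall_congr' fun l => ?_
  simp [canonicalBijection, Finset.sum_apply]

section RealFormula

variable {σ : TriangleSchema} {β γ : Type}

/-- A predicate on databases and real tuples that is defined by a real formula, uniformly in the
database and for every way of placing the entries of the tuple among the variables of the
formula. -/
def RealDefinable (P : TriangleDatabase σ → (β → ℝ) → Prop) : Prop :=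
  ∀ (α : Type) (n : ℕ) (v : β → α ⊕ Fin n), ∃ ψ : RealFormula σ α n,
    ∀ D x y, ψ.Realize D x y ↔ P D (Sum.elim x y ∘ v)

namespace RealDefinable

variable {P Q : TriangleDatabase σ → (β → ℝ) → Prop}

lemma not (hP : RealDefinable P) : RealDefinable fun D x => ¬ P D x := fun α n v => by
  obtain ⟨φ, hφ⟩ := hP α n v
  exact ⟨φ.not, fun D x y => not_congr (hφ D x y)⟩

lemma and (hP : RealDefinable P) (hQ : RealDefinable Q) :
    RealDefinable fun D x => P D x ∧ Q D x := fun α n v => by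
  obtain ⟨φ, hφ⟩ := hP α n v
  obtain ⟨ψ, hψ⟩ := hQ α n v
  exact ⟨φ.and ψ, fun D x y => and_congr (hφ D x y) (hψ D x y)⟩

lemma or (hP : RealDefinable P) (hQ : RealDefinable Q) :
    RealDefinable fun D x => P D x ∨ Q D x := fun α n v => by
  obtain ⟨φ, hφ⟩ := hP α n v
  obtain ⟨ψ, hψ⟩ := hQ α n v
  exact ⟨φ.or ψ, fun D x y => or_congr (hφ D x y) (hψ D x y)⟩

lemma reindex (hP : RealDefinable P) (e : β → γ) :
    RealDefinable fun D (x : γ → ℝ) => P D (x ∘ e) := fun α n v => hP α n (v ∘ e)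

lemma exists_option {P : TriangleDatabase σ → (Option β → ℝ) → Prop} (hP : RealDefinable P) :
    RealDefinable fun D (x : β → ℝ) => ∃ a, P D (fun o => o.elim a x) := fun α n v => by
  obtain ⟨φ, hφ⟩ := hP α (n + 1)
    (fun o => o.elim (Sum.inr (Fin.last n)) fun b => Sum.map id Fin.castSucc (v b))
  refine ⟨φ.ex, fun D x y => exists_congr fun a => ?_⟩
  rw [hφ]
  convert Iff.rfl using 2
  ext o
  rcases o with _ | b
  · simp
  · simp only [Function.comp, Option.elim_some]
    rcases v b with i | i <;> simp

lemma exists_family [Finite γ] {P : TriangleDatabase σ → (β ⊕ γ → ℝ) → Prop}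
    (hP : RealDefinable P) :
    RealDefinable fun D (x : β → ℝ) => ∃ z : γ → ℝ, P D (Sum.elim x z) :=
  exists_family_of_exists (fun _ P => RealDefinable P) (fun _ _ e _ h => h.reindex e)
    (fun _ _ h => h.exists_option) γ β P hP

lemma of_isSemialgebraic {S : Set (β → ℝ)} (hS : IsSemialgebraic S) :
    RealDefinable fun (_ : TriangleDatabase σ) x => x ∈ S := by
  induction hS with
  | pos p =>
    intro α n v
    refine ⟨.pos (MvPolynomial.rename v p), fun D x y => ?_⟩
    simp [RealFormula.Realize, MvPolynomial.aeval_rename]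
  | compl _ ih => exact ih.not
  | inter _ _ ih₁ ih₂ => exact ih₁.and ih₂
  | union _ _ ih₁ ih₂ => exact ih₁.or ih₂

lemma rel (R : σ.Name) : RealDefinable fun (D : TriangleDatabase σ) x =>
    x ∈ canonicalBijection (σ.arity R) '' (D.rel R).carrier := fun α n v => by
  refine ⟨.rel R fun l => MvPolynomial.X (v l), fun D x y => ?_⟩
  simp [RealFormula.Realize, Function.comp_def]

end RealDefinable

lemma RealFormula.isSemialgebraic_realize (D : TriangleDatabase σ) {α : Type} {n : ℕ}
    (ψ : RealFormula σ α n) : IsSemialgebraic {z : α ⊕ Fin n → ℝ |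
      ψ.Realize D (fun a => z (Sum.inl a)) (fun i => z (Sum.inr i))} := by
  have hex : ∀ {n : ℕ} {ψ : RealFormula σ α (n + 1)}, IsSemialgebraic {z : α ⊕ Fin (n + 1) → ℝ |
      ψ.Realize D (fun a => z (Sum.inl a)) (fun i => z (Sum.inr i))} →
      IsSemialgebraic {z : α ⊕ Fin n → ℝ | ∃ a, ψ.Realize D (fun a => z (Sum.inl a))
        (Fin.snoc (α := fun _ => ℝ) (fun i => z (Sum.inr i)) a)} := by
    intro n ψ h
    convert (h.reindex (Sum.elim (fun a => some (Sum.inl a))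
      (Fin.snoc (α := fun _ => Option (α ⊕ Fin n)) (fun i => some (Sum.inr i)) none)) :
      IsSemialgebraic _).exists_option using 1
    ext z
    refine exists_congr fun a => ?_
    simp only [Set.mem_ofPred_eq, Function.comp, Sum.elim_inl, Sum.elim_inr, Option.elim_some]
    convert Iff.rfl using 2
    ext i
    refine Fin.lastCases ?_ (fun i => ?_) i <;> simp
  induction ψ with
  | pos p =>
    convert IsSemialgebraic.pos p using 1
    ext z
    simp only [RealFormula.Realize, Set.mem_ofPred_eq]
    convert Iff.rfl using 4
    ext i; rcases i with i | i <;> rfl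
  | rel R t =>
    convert (D.rel R).semialgebraic.preimage t using 1
    ext z
    simp only [RealFormula.Realize, Set.mem_ofPred_eq]
    convert Iff.rfl using 5
    ext i; rcases i with i | i <;> rfl
  | not _ ih => exact ih.compl
  | and _ _ ih₁ ih₂ => exact ih₁.inter ih₂
  | or _ _ ih₁ ih₂ => exact ih₁.union ih₂
  | ex _ ih => exact hex ih
  | @all n ψ ih =>
    convert (hex (ψ := ψ.not) ih.compl).compl using 1
    ext z
    simp [RealFormula.Realize]

end RealFormula

section TriangleFormula

variable {σ : TriangleSchema}

/-- Every triangle formula can be read in the real coordinates of its triangles. -/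
lemma TriangleFormula.realDefinable {n : ℕ} (φ : TriangleFormula σ n) :
    RealDefinable fun (D : TriangleDatabase σ) x =>
      φ.Realize D ((canonicalBijection n).symm x) := by
  have hpart : ∀ {n : ℕ} (i j : Fin n), RealDefinable fun (_ : TriangleDatabase σ) x =>
      Triangle.PartOf ((canonicalBijection n).symm x i) ((canonicalBijection n).symm x j) := by
    intro n i j
    exact (RealDefinable.of_isSemialgebraic Triangle.isSemialgebraic_partOf).reindex
      (fun p : CoordIndex 2 => ((![i, j] p.1, p.2.1, p.2.2) : CoordIndex n))
  have hex : ∀ {n : ℕ} {ψ : TriangleFormula σ (n + 1)},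
      (RealDefinable fun (D : TriangleDatabase σ) x =>
        ψ.Realize D ((canonicalBijection (n + 1)).symm x)) →
      RealDefinable fun (D : TriangleDatabase σ) x => ∃ T : Triangle,
        ψ.Realize D (Fin.snoc (α := fun _ => Triangle) ((canonicalBijection n).symm x) T) := by
    intro n ψ h
    have h1 := (h.reindex fun p : CoordIndex (n + 1) =>
      (Fin.lastCases (motive := fun _ => CoordIndex n ⊕ Fin 3 × Fin 2) (Sum.inr (p.2.1, p.2.2))
        (fun i => Sum.inl (i, p.2.1, p.2.2)) p.1)).exists_family
    convert h1 using 3 with D x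
    rw [((Equiv.curry (Fin 3) (Fin 2) ℝ).symm).exists_congr_left]
    refine exists_congr fun z => ?_
    convert Iff.rfl using 2
    ext i j l
    refine Fin.lastCases ?_ (fun i => ?_) i <;> simp [canonicalBijection]
  induction φ with
  | eq i j => exact (hpart i j).and (hpart j i)
  | partOf i j => exact hpart i j
  | rel R v =>
    convert (RealDefinable.rel (σ := σ) R).reindex
      (fun p : CoordIndex (σ.arity R) => (v p.1, p.2.1, p.2.2)) using 3 with D x
    rw [Equiv.image_eq_preimage_symm]
    rfl
  | not _ ih => exact ih.not
  | and _ _ ih₁ ih₂ => exact ih₁.and ih₂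
  | or _ _ ih₁ ih₂ => exact ih₁.or ih₂
  | ex _ ih => exact hex ih
  | @all n ψ ih =>
    convert (hex (ψ := ψ.not) ih.not).not using 3 with D x
    simp [TriangleFormula.Realize]

/-- A triangle formula does not distinguish triangles with the same drawing. -/
lemma TriangleFormula.realize_of_drawing_eq (D : TriangleDatabase σ) {n : ℕ}
    (φ : TriangleFormula σ n) {c c' : Fin n → Triangle}
    (h : ∀ i, (c i).drawing = (c' i).drawing) : φ.Realize D c ↔ φ.Realize D c' := by
  have hsnoc : ∀ {n : ℕ} {c c' : Fin n → Triangle}, (∀ i, (c i).drawing = (c' i).drawing) →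
      ∀ (T : Triangle) (i : Fin (n + 1)), (Fin.snoc (α := fun _ => Triangle) c T i).drawing =
        (Fin.snoc (α := fun _ => Triangle) c' T i).drawing := by
    intro n c c' h T i
    refine Fin.lastCases ?_ (fun i => ?_) i
    · simp
    · simpa using h i
  induction φ with
  | eq i j => simp only [TriangleFormula.Realize, Triangle.triEq_iff, h]
  | partOf i j => simp only [TriangleFormula.Realize, Triangle.PartOf, h]
  | rel R v =>
    exact ⟨(D.rel R).consistent _ _ fun i => h (v i),
      (D.rel R).consistent _ _ fun i => (h (v i)).symm⟩
  | not _ ih => exact not_congr (ih h)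
  | and _ _ ih₁ ih₂ => exact and_congr (ih₁ h) (ih₂ h)
  | or _ _ ih₁ ih₂ => exact or_congr (ih₁ h) (ih₂ h)
  | ex _ ih => exact exists_congr fun T => ih (hsnoc h T)
  | all _ ih => exact forall_congr' fun T => ih (hsnoc h T)

/-- The image of a triangle under an affinity, taken corner point by corner point. -/
def Affinity.mapTriangle (g : Affinity) (T : Triangle) : Triangle := fun j => g (T j)

lemma Affinity.drawing_mapTriangle (g : Affinity) (T : Triangle) :
    (g.mapTriangle T).drawing = g '' T.drawing := by
  have h := (g : PlanePoint →ᵃ[ℝ] PlanePoint).image_convexHull (Set.range T)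
  rw [AffineEquiv.coe_coe] at h
  rw [Triangle.drawing, Triangle.drawing, h, ← Set.range_comp]
  rfl

lemma Affinity.mapTuple_injective (g : Affinity) {k : ℕ} :
    Function.Injective (g.mapTuple (k := k)) := fun c c' h => by
  ext1 i; ext1 j
  exact g.injective (congrFun (congrFun h i) j)

lemma Affinity.mapTuple_mapTuple_symm (g : Affinity) {k : ℕ} (c : Fin k → Triangle) :
    g.mapTuple (Affinity.mapTuple g.symm c) = c := by
  ext1 i; ext1 j
  exact g.apply_symm_apply _

/-- Truth of a triangle formula is invariant under affinities. -/
lemma TriangleFormula.realize_mapTuple (g : Affinity) {D D' : TriangleDatabase σ}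
    (h : D.IsImage g D') {n : ℕ} (φ : TriangleFormula σ n) (c : Fin n → Triangle) :
    φ.Realize D' (g.mapTuple c) ↔ φ.Realize D c := by
  have hpart : ∀ T₁ T₂ : Triangle,
      (g.mapTriangle T₁).PartOf (g.mapTriangle T₂) ↔ T₁.PartOf T₂ := by
    intro T₁ T₂
    rw [Triangle.PartOf, g.drawing_mapTriangle, g.drawing_mapTriangle,
      Set.image_subset_image_iff g.injective]
    rfl
  have hsnoc : ∀ {n : ℕ} (c : Fin n → Triangle) (T : Triangle),
      Fin.snoc (α := fun _ => Triangle) (g.mapTuple c) (g.mapTriangle T) =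
        g.mapTuple (Fin.snoc (α := fun _ => Triangle) c T) := by
    intro n c T
    ext1 i
    change _ = g.mapTriangle (Fin.snoc (α := fun _ => Triangle) c T i)
    refine Fin.lastCases ?_ (fun i => ?_) i
    · rw [Fin.snoc_last, Fin.snoc_last]
    · rw [Fin.snoc_castSucc, Fin.snoc_castSucc]
      rfl
  have hsurj : Function.Surjective g.mapTriangle := fun T =>
    ⟨Affinity.mapTriangle g.symm T, by ext1 j; exact g.apply_symm_apply _⟩
  induction φ with
  | eq i j => exact and_congr (hpart _ _) (hpart _ _)
  | partOf i j => exact hpart _ _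
  | rel R v =>
    have := g.mapTuple_injective.mem_set_image (s := (D.rel R).carrier) (a := fun l => c (v l))
    rw [← h R] at this
    exact this
  | not _ ih => exact not_congr (ih c)
  | and _ _ ih₁ ih₂ => exact and_congr (ih₁ c) (ih₂ c)
  | or _ _ ih₁ ih₂ => exact or_congr (ih₁ c) (ih₂ c)
  | ex _ ih =>
    refine hsurj.exists.trans (exists_congr fun T => ?_)
    rw [hsnoc]
    exact ih _
  | all _ ih =>
    refine hsurj.forall.trans (forall_congr' fun T => ?_)
    rw [hsnoc]
    exact ih _

lemma TriangleFormula.exists_realFormula {k : ℕ} (φ : TriangleFormula σ k) :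
    ∃ ψ : RealFormula σ (CoordIndex k) 0, ∀ D x,
      ψ.Realize D x Fin.elim0 ↔ φ.Realize D ((canonicalBijection k).symm x) := by
  obtain ⟨ψ, hψ⟩ := φ.realDefinable (CoordIndex k) 0 Sum.inl
  exact ⟨ψ, fun D x => hψ D x Fin.elim0⟩

lemma TriangleFormula.isSemialgebraic_realize (D : TriangleDatabase σ) {k : ℕ}
    (φ : TriangleFormula σ k) :
    IsSemialgebraic (canonicalBijection k '' {c | φ.Realize D c}) := by
  obtain ⟨ψ, hψ⟩ := φ.exists_realFormula
  convert (ψ.isSemialgebraic_realize D).reindex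
    (Sum.elim id Fin.elim0 : CoordIndex k ⊕ Fin 0 → CoordIndex k) using 1
  ext x
  rw [Equiv.image_eq_preimage_symm]
  refine (hψ D x).symm.trans ?_
  simp only [Set.mem_ofPred_eq, Function.comp, Sum.elim_inl, id]
  convert Iff.rfl using 2

/-- The query expressed by a triangle formula. -/
def TriangleFormula.toQuery {k : ℕ} (φ : TriangleFormula σ k) : TriangleQuery σ k := fun D =>
  { carrier := {c | φ.Realize D c}
    semialgebraic := φ.isSemialgebraic_realize D
    consistent := fun _ _ h hc => (φ.realize_of_drawing_eq D h).1 hc }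

lemma TriangleFormula.isFirstOrder_toQuery {k : ℕ} (φ : TriangleFormula σ k) :
    φ.toQuery.IsFirstOrder := by
  obtain ⟨ψ, hψ⟩ := φ.exists_realFormula
  refine ⟨ψ, fun D => ?_⟩
  ext x
  rw [Equiv.image_eq_preimage_symm]
  exact (hψ D x).symm

lemma TriangleFormula.affineGeneric_toQuery {k : ℕ} (φ : TriangleFormula σ k) :
    φ.toQuery.AffineGeneric := by
  intro g D D' h
  ext c
  constructor
  · intro hc
    refine ⟨Affinity.mapTuple g.symm c, ?_, g.mapTuple_mapTuple_symm c⟩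
    rw [← g.mapTuple_mapTuple_symm c] at hc
    exact (φ.realize_mapTuple g h _).1 hc
  · rintro ⟨c, hc, rfl⟩
    exact (φ.realize_mapTuple g h _).2 hc

end TriangleFormula

/-! ### Points, segments and parallels in the triangle logic -/

section Points

/-- The degenerate triangle that stands for a point. -/
def pointTriangle (p : PlanePoint) : Triangle := fun _ => p

lemma drawing_pointTriangle (p : PlanePoint) : (pointTriangle p).drawing = {p} := by
  simp [Triangle.drawing, pointTriangle]

/-- The points are the triangles that are minimal for `PartOf`. -/
lemma Triangle.exists_drawing_eq_singleton_iff {T : Triangle} :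
    (∃ p, T.drawing = {p}) ↔ ∀ S : Triangle, S.PartOf T → T.PartOf S := by
  constructor
  · rintro ⟨p, hp⟩ S hS
    rw [Triangle.PartOf, hp] at hS ⊢
    rw [Set.singleton_subset_iff]
    have h := hS (S.corner_mem_drawing 0)
    rw [← Set.mem_singleton_iff.1 h]
    exact S.corner_mem_drawing 0
  · intro h
    have h1 : (pointTriangle (T 0)).PartOf T := by
      rw [Triangle.PartOf, drawing_pointTriangle, Set.singleton_subset_iff]
      exact T.corner_mem_drawing 0
    refine ⟨T 0, Set.Subset.antisymm ?_ ?_⟩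
    · rw [← drawing_pointTriangle]; exact h _ h1
    · rw [← drawing_pointTriangle]; exact h1

/-- The segment between `p` and `q`, in terms of the triangles that contain points. -/
lemma mem_segment_iff_forall_triangle {p q r : PlanePoint} :
    r ∈ segment ℝ p q ↔
      ∀ T : Triangle, p ∈ T.drawing ∧ q ∈ T.drawing → r ∈ T.drawing := by
  constructor
  · rintro h T ⟨hp, hq⟩
    exact (convex_convexHull ℝ _).segment_subset hp hq h
  · intro h
    have h1 : Triangle.drawing ![p, q, q] = segment ℝ p q := by
      rw [Triangle.drawing, ← convexHull_pair]
      congr 1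
      simp [Matrix.range_cons, Set.pair_comm]
    rw [← h1]
    exact h _ ⟨Triangle.corner_mem_drawing ![p, q, q] 0, Triangle.corner_mem_drawing ![p, q, q] 1⟩

end Points

section Expressible

variable {σ : TriangleSchema} {ι κ ι' κ' : Type}

/-- A predicate on databases, tuples of triangles and tuples of points that is expressed by a
triangle formula, uniformly in the database and for every way of placing the entries of the tuples
among the variables. A variable for a point takes as its value any triangle that is drawn as that
point. -/
def Expressible (P : TriangleDatabase σ → (ι → Triangle) → (κ → PlanePoint) → Prop) : Prop :=
  ∀ (n : ℕ) (v : ι → Fin n) (w : κ → Fin n), ∃ φ : TriangleFormula σ n, ∀ D c a,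
    (∀ k, (c (w k)).drawing = {a k}) → (φ.Realize D c ↔ P D (c ∘ v) a)

namespace Expressible

variable {P Q : TriangleDatabase σ → (ι → Triangle) → (κ → PlanePoint) → Prop}

lemma congr (hP : Expressible P) (h : ∀ D c a, P D c a ↔ Q D c a) : Expressible Q := by
  have : P = Q := by ext; exact h _ _ _
  rwa [← this]

lemma not (hP : Expressible P) : Expressible fun D c a => ¬ P D c a := fun n v w => by
  obtain ⟨φ, hφ⟩ := hP n v w
  exact ⟨φ.not, fun D c a h => not_congr (hφ D c a h)⟩

lemma and (hP : Expressible P) (hQ : Expressible Q) :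
    Expressible fun D c a => P D c a ∧ Q D c a := fun n v w => by
  obtain ⟨φ, hφ⟩ := hP n v w
  obtain ⟨ψ, hψ⟩ := hQ n v w
  exact ⟨φ.and ψ, fun D c a h => and_congr (hφ D c a h) (hψ D c a h)⟩

lemma or (hP : Expressible P) (hQ : Expressible Q) :
    Expressible fun D c a => P D c a ∨ Q D c a := fun n v w => by
  obtain ⟨φ, hφ⟩ := hP n v w
  obtain ⟨ψ, hψ⟩ := hQ n v w
  exact ⟨φ.or ψ, fun D c a h => or_congr (hφ D c a h) (hψ D c a h)⟩

lemma imp (hP : Expressible P) (hQ : Expressible Q) :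
    Expressible fun D c a => P D c a → Q D c a :=
  (hP.not.or hQ).congr fun _ _ _ => imp_iff_not_or.symm

lemma true : Expressible fun (_ : TriangleDatabase σ) (_ : ι → Triangle) (_ : κ → PlanePoint) =>
    True := fun n v w => by
  refine ⟨.all (.eq (Fin.last n) (Fin.last n)), fun D c a _ => ?_⟩
  simp only [TriangleFormula.Realize, iff_true]
  exact fun T => ⟨subset_rfl, subset_rfl⟩

lemma forall_finite {τ : Type} [Finite τ]
    {P : τ → TriangleDatabase σ → (ι → Triangle) → (κ → PlanePoint) → Prop}
    (h : ∀ t, Expressible (P t)) : Expressible fun D c a => ∀ t, P t D c a := by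
  suffices ∀ s : Set τ, s.Finite → Expressible fun D c a => ∀ t ∈ s, P t D c a by
    simpa using this Set.univ Set.finite_univ
  intro s hs
  induction s, hs using Set.Finite.induction_on with
  | empty => exact true.congr fun _ _ _ => by simp
  | @insert t s _ _ ih => exact ((h t).and ih).congr fun _ _ _ => by simp

lemma reindex (hP : Expressible P) (f : ι → ι') (g : κ → κ') :
    Expressible fun D (c : ι' → Triangle) (a : κ' → PlanePoint) => P D (c ∘ f) (a ∘ g) :=
  fun n v w => by
    obtain ⟨φ, hφ⟩ := hP n (v ∘ f) (w ∘ g)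
    exact ⟨φ, fun D c a h => hφ D c (a ∘ g) fun k => h (g k)⟩

lemma exists_triangle
    {P : TriangleDatabase σ → (Option ι → Triangle) → (κ → PlanePoint) → Prop}
    (hP : Expressible P) : Expressible fun D c a => ∃ T, P D (fun o => o.elim T c) a :=
  fun n v w => by
    obtain ⟨φ, hφ⟩ := hP (n + 1) (fun o => o.elim (Fin.last n) fun i => (v i).castSucc)
      (fun k => (w k).castSucc)
    refine ⟨φ.ex, fun D c a h => exists_congr fun T => ?_⟩
    rw [hφ D _ a fun k => by simpa using h k]
    convert Iff.rfl using 2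
    ext1 o
    rcases o with _ | i <;> simp

lemma exists_point
    {P : TriangleDatabase σ → (ι → Triangle) → (Option κ → PlanePoint) → Prop}
    (hP : Expressible P) : Expressible fun D c a => ∃ p, P D c (fun o => o.elim p a) :=
  fun n v w => by
    obtain ⟨φ, hφ⟩ := hP (n + 1) (fun i => (v i).castSucc)
      (fun o => o.elim (Fin.last n) fun k => (w k).castSucc)
    refine ⟨.ex (.and (.all (.or (.not (.partOf (Fin.last _) (Fin.last n).castSucc))
      (.partOf (Fin.last n).castSucc (Fin.last _)))) φ), fun D c a h => ?_⟩
    simp only [TriangleFormula.Realize, Fin.snoc_last, Fin.snoc_castSucc, ← imp_iff_not_or,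
      ← Triangle.exists_drawing_eq_singleton_iff]
    have key : ∀ (T : Triangle) (p : PlanePoint), T.drawing = {p} →
        (φ.Realize D (Fin.snoc (α := fun _ => Triangle) c T) ↔
          P D (c ∘ v) (fun o => o.elim p a)) := by
      intro T p hT
      rw [hφ D _ (fun o => o.elim p a) fun o => by
        rcases o with _ | k
        · simpa using hT
        · simpa using h k]
      convert Iff.rfl using 2
      ext1 i
      simp
    constructor
    · rintro ⟨T, ⟨p, hp⟩, hT⟩
      exact ⟨p, (key T p hp).1 hT⟩
    · rintro ⟨p, hp⟩
      exact ⟨pointTriangle p, ⟨p, drawing_pointTriangle p⟩,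
        (key _ p (drawing_pointTriangle p)).2 hp⟩

lemma forall_triangle
    {P : TriangleDatabase σ → (Option ι → Triangle) → (κ → PlanePoint) → Prop}
    (hP : Expressible P) : Expressible fun D c a => ∀ T, P D (fun o => o.elim T c) a :=
  hP.not.exists_triangle.not.congr fun _ _ _ => by simp

lemma exists_points [Finite κ']
    {P : TriangleDatabase σ → (ι → Triangle) → (κ ⊕ κ' → PlanePoint) → Prop}
    (hP : Expressible P) : Expressible fun D c a => ∃ b : κ' → PlanePoint, P D c (Sum.elim a b) :=
  exists_family_of_exists (δ := TriangleDatabase σ × (ι → Triangle))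
    (fun _ P => Expressible fun D c a => P (D, c) a) (fun _ _ e _ h => h.reindex id e)
    (fun _ _ h => h.exists_point) κ' κ (fun d a => P d.1 d.2 a) hP

lemma exists_triangles [Finite ι']
    {P : TriangleDatabase σ → (ι ⊕ ι' → Triangle) → (κ → PlanePoint) → Prop}
    (hP : Expressible P) : Expressible fun D c a => ∃ T : ι' → Triangle, P D (Sum.elim c T) a :=
  exists_family_of_exists (δ := TriangleDatabase σ × (κ → PlanePoint))
    (fun _ P => Expressible fun D c a => P (D, a) c) (fun _ _ e _ h => h.reindex e id)
    (fun _ _ h => h.exists_triangle) ι' ι (fun d c => P d.1 c d.2) hP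

lemma forall_points [Finite κ']
    {P : TriangleDatabase σ → (ι → Triangle) → (κ ⊕ κ' → PlanePoint) → Prop}
    (hP : Expressible P) : Expressible fun D c a => ∀ b : κ' → PlanePoint, P D c (Sum.elim a b) :=
  hP.not.exists_points.not.congr fun _ _ _ => by simp

variable (σ)

lemma partOf (i j : ι) : Expressible fun (_ : TriangleDatabase σ) (c : ι → Triangle)
    (_ : κ → PlanePoint) => (c i).PartOf (c j) := fun _ v _ =>
  ⟨.partOf (v i) (v j), fun _ _ _ _ => Iff.rfl⟩

lemma mem (k : κ) (i : ι) : Expressible fun (_ : TriangleDatabase σ) (c : ι → Triangle)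
    (a : κ → PlanePoint) => a k ∈ (c i).drawing := fun n v w => by
  refine ⟨.partOf (w k) (v i), fun D c a h => ?_⟩
  simp only [TriangleFormula.Realize, Triangle.PartOf, h, Set.singleton_subset_iff]
  rfl

lemma pointEq (k l : κ) : Expressible fun (_ : TriangleDatabase σ) (_ : ι → Triangle)
    (a : κ → PlanePoint) => a k = a l := fun n v w => by
  refine ⟨.partOf (w k) (w l), fun D c a h => ?_⟩
  simp [TriangleFormula.Realize, Triangle.PartOf, h]

variable {σ} in
lemma rel (R : σ.Name) (u : Fin (σ.arity R) → ι) : Expressible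
    fun (D : TriangleDatabase σ) (c : ι → Triangle) (_ : κ → PlanePoint) =>
      c ∘ u ∈ (D.rel R).carrier := fun _ v _ =>
  ⟨.rel R (v ∘ u), fun _ _ _ _ => Iff.rfl⟩

lemma segment (p q r : κ) : Expressible fun (_ : TriangleDatabase σ) (_ : ι → Triangle)
    (a : κ → PlanePoint) => a r ∈ segment ℝ (a p) (a q) := by
  have h := ((((mem σ (ι := Option ι) p none).and (mem σ q none)).imp
    (mem σ r none)).forall_triangle)
  exact h.congr fun _ _ _ => mem_segment_iff_forall_triangle.symm

end Expressible

end Expressible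

section Parallel

/-- The vectors `q - p` and `s - r` are linearly dependent. -/
def Parallel (p q r s : PlanePoint) : Prop :=
  (q 0 - p 0) * (s 1 - r 1) = (q 1 - p 1) * (s 0 - r 0)

lemma parallel_iff_mem_segment {p q r : PlanePoint} : Parallel p q p r ↔
    r ∈ segment ℝ p q ∨ q ∈ segment ℝ p r ∨ p ∈ segment ℝ q r := by
  constructor
  · intro h
    have hcol : Collinear ℝ {p, r, q} := by
      rw [collinear_iff_of_mem (p₀ := p) (by simp)]
      by_cases hpq : q = p
      · refine ⟨r - p, ?_⟩
        simp only [hpq, Set.mem_insert_iff, Set.mem_singleton_iff, forall_eq_or_imp, forall_eq,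
          vadd_eq_add]
        exact ⟨⟨0, by simp⟩, ⟨1, by simp⟩, ⟨0, by simp⟩⟩
      obtain ⟨t, ht⟩ : ∃ t : ℝ, r = t • (q - p) + p := by
        by_cases h0 : q 0 - p 0 = 0
        · have h1 : q 1 - p 1 ≠ 0 := fun h1 => hpq (by
            ext l; fin_cases l
            · exact sub_eq_zero.1 h0
            · exact sub_eq_zero.1 h1)
          refine ⟨(r 1 - p 1) / (q 1 - p 1), ?_⟩
          have h2 : r 0 - p 0 = 0 := by
            rw [Parallel, h0, zero_mul, eq_comm] at h
            exact (mul_eq_zero.1 h).resolve_left h1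
          ext l; fin_cases l
          · simp only [Fin.zero_eta, Pi.add_apply, Pi.smul_apply, Pi.sub_apply, smul_eq_mul, h0]
            linarith
          · simp only [Fin.mk_one, Pi.add_apply, Pi.smul_apply, Pi.sub_apply, smul_eq_mul]
            field_simp
            ring
        · refine ⟨(r 0 - p 0) / (q 0 - p 0), ?_⟩
          rw [Parallel] at h
          ext l; fin_cases l
          · simp only [Fin.zero_eta, Pi.add_apply, Pi.smul_apply, Pi.sub_apply, smul_eq_mul]
            field_simp
            ring
          · simp only [Fin.mk_one, Pi.add_apply, Pi.smul_apply, Pi.sub_apply, smul_eq_mul]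
            field_simp
            linarith
      refine ⟨q - p, ?_⟩
      simp only [Set.mem_insert_iff, Set.mem_singleton_iff, forall_eq_or_imp, forall_eq,
        vadd_eq_add]
      exact ⟨⟨0, by simp⟩, ⟨t, ht⟩, ⟨1, by simp⟩⟩
    rcases hcol.wbtw_or_wbtw_or_wbtw with h | h | h
    · exact Or.inl (mem_segment_iff_wbtw.2 h)
    · exact Or.inr (Or.inl (mem_segment_iff_wbtw.2 h.symm))
    · exact Or.inr (Or.inr (mem_segment_iff_wbtw.2 h))
  · have key : ∀ x y z : PlanePoint, z ∈ segment ℝ x y → ∃ t : ℝ,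
        (z 0 = x 0 + t * (y 0 - x 0)) ∧ (z 1 = x 1 + t * (y 1 - x 1)) := by
      rintro x y z ⟨a, b, -, -, hab, rfl⟩
      obtain rfl : a = 1 - b := by linarith
      refine ⟨b, ?_, ?_⟩ <;> simp <;> ring
    rw [Parallel]
    rintro (h | h | h) <;> obtain ⟨t, h0, h1⟩ := key _ _ _ h <;> rw [h0, h1] <;> ring

lemma parallel_iff_exists {p q r s : PlanePoint} : Parallel p q r s ↔
    p = q ∨ r = s ∨ (¬ ∃ x, Parallel p q p x ∧ Parallel r s r x) ∨
      (Parallel p q p r ∧ Parallel p q p s) := by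
  simp only [Parallel]
  constructor
  · intro h
    by_cases hrs : r = s
    · exact Or.inr (Or.inl hrs)
    by_cases hx : ∃ x : PlanePoint, (q 0 - p 0) * (x 1 - p 1) = (q 1 - p 1) * (x 0 - p 0) ∧
        (s 0 - r 0) * (x 1 - r 1) = (s 1 - r 1) * (x 0 - r 0)
    · obtain ⟨x, h1, h2⟩ := hx
      have key : (q 0 - p 0) * (r 1 - p 1) = (q 1 - p 1) * (r 0 - p 0) := by
        by_cases h0 : s 0 - r 0 = 0
        · have h3 : s 1 - r 1 ≠ 0 := fun h3 => hrs (by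
            ext l; fin_cases l
            · exact (sub_eq_zero.1 h0).symm
            · exact (sub_eq_zero.1 h3).symm)
          apply mul_left_cancel₀ h3
          linear_combination (s 1 - r 1) * h1 - (x 1 - r 1) * h - (q 1 - p 1) * h2
        · apply mul_left_cancel₀ h0
          linear_combination (s 0 - r 0) * h1 - (x 0 - r 0) * h - (q 0 - p 0) * h2
      exact Or.inr (Or.inr (Or.inr ⟨key, by linear_combination key + h⟩))
    · exact Or.inr (Or.inr (Or.inl hx))
  · rintro (rfl | rfl | h | ⟨h1, h2⟩)
    · ring
    · ring
    · by_contra h0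
      apply h
      have h1 : (q 0 - p 0) * (s 1 - r 1) - (q 1 - p 1) * (s 0 - r 0) ≠ 0 := sub_ne_zero.2 h0
      obtain ⟨t, ht⟩ : ∃ t : ℝ, t * ((q 0 - p 0) * (s 1 - r 1) - (q 1 - p 1) * (s 0 - r 0)) =
          (r 0 - p 0) * (s 1 - r 1) - (r 1 - p 1) * (s 0 - r 0) := ⟨_, div_mul_cancel₀ _ h1⟩
      refine ⟨![p 0 + t * (q 0 - p 0), p 1 + t * (q 1 - p 1)], ?_, ?_⟩
      · simp only [Matrix.cons_val_zero, Matrix.cons_val_one]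
        ring
      · simp only [Matrix.cons_val_zero, Matrix.cons_val_one]
        linear_combination -ht
    · linear_combination h2 - h1

lemma Parallel.map (g : Affinity) {p q r s : PlanePoint} (h : Parallel p q r s) :
    Parallel (g p) (g q) (g r) (g s) := by
  have key : ∀ (x y : PlanePoint) (l : Fin 2), g y l - g x l =
      (y 0 - x 0) * g.linear ![1, 0] l + (y 1 - x 1) * g.linear ![0, 1] l := by
    intro x y l
    have h1 : g y - g x = g.linear (y - x) := by
      have := g.toAffineMap.linearMap_vsub y x
      simpa using this.symm
    have h2 : y - x = (y 0 - x 0) • ![1, 0] + (y 1 - x 1) • ![0, 1] := by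
      ext l; fin_cases l <;> simp
    rw [← Pi.sub_apply, h1, h2, map_add, map_smul, map_smul]
    rfl
  rw [Parallel] at h ⊢
  rw [key, key, key, key]
  linear_combination (g.linear ![1, 0] 0 * g.linear ![0, 1] 1 -
    g.linear ![1, 0] 1 * g.linear ![0, 1] 0) * h

lemma parallel_map_iff (g : Affinity) {p q r s : PlanePoint} :
    Parallel (g p) (g q) (g r) (g s) ↔ Parallel p q r s := by
  refine ⟨fun h => ?_, Parallel.map g⟩
  have := h.map g.symm
  simpa only [AffineEquiv.symm_apply_apply] using this

variable (σ : TriangleSchema) {ι κ : Type}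

lemma Expressible.parallel (p q r s : κ) : Expressible fun (_ : TriangleDatabase σ)
    (_ : ι → Triangle) (a : κ → PlanePoint) => Parallel (a p) (a q) (a r) (a s) := by
  have hcol : ∀ {κ : Type} (p q r : κ), Expressible fun (_ : TriangleDatabase σ)
      (_ : ι → Triangle) (a : κ → PlanePoint) => Parallel (a p) (a q) (a p) (a r) := by
    intro κ p q r
    exact ((Expressible.segment σ p q r).or ((Expressible.segment σ p r q).or
      (Expressible.segment σ q r p))).congr fun _ _ _ => parallel_iff_mem_segment.symm
  have hx := ((hcol (some p) (some q) none).and (hcol (some r) (some s) none)).exists_point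
  exact ((Expressible.pointEq σ p q).or ((Expressible.pointEq σ r s).or (hx.not.or
    ((hcol p q r).and (hcol p q s))))).congr fun _ _ _ => parallel_iff_exists.symm

end Parallel

/-! ### Real arithmetic relative to an affine frame -/

section Coordinates

/-- The standard affine frame of the plane: the origin and the two unit points. -/
def standardFrame : Fin 3 → PlanePoint := ![![0, 0], ![1, 0], ![0, 1]]

/-- With respect to the frame `e`, the first coordinate of `q` is that of the point `X` of the
first axis, and the second coordinate of `q` is the first coordinate of the point `Y` of the first
axis. The witness `y` is the point of the second axis that corresponds to `Y`. -/
def HasCoordinates (e : Fin 3 → PlanePoint) (X Y q : PlanePoint) : Prop :=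
  ∃ y, Parallel (e 0) (e 2) (e 0) y ∧ Parallel (e 1) (e 2) Y y ∧ Parallel (e 0) (e 2) X q ∧
    Parallel (e 0) (e 1) y q

lemma hasCoordinates_iff (g : Affinity) {x y : ℝ} {q : PlanePoint} :
    HasCoordinates (g ∘ standardFrame) (g ![x, 0]) (g ![y, 0]) q ↔ q = g ![x, y] := by
  obtain ⟨q, rfl⟩ := g.surjective q
  rw [HasCoordinates, g.surjective.exists, g.injective.eq_iff]
  simp only [Function.comp, parallel_map_iff]
  simp only [Parallel, standardFrame, Matrix.cons_val_zero, Matrix.cons_val_one, Matrix.cons_val]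
  constructor
  · rintro ⟨p, h1, h2, h3, h4⟩
    ext l; fin_cases l
    · simp only [Fin.zero_eta, Matrix.cons_val_zero]; linarith
    · simp only [Fin.mk_one, Matrix.cons_val_one, Matrix.cons_val_zero]; linarith
  · rintro rfl
    refine ⟨![0, y], ?_⟩
    simp

lemma exists_eq_axis_iff (g : Affinity) {p : PlanePoint} :
    Parallel (g (standardFrame 0)) (g (standardFrame 1)) (g (standardFrame 0)) p ↔
      ∃ x : ℝ, p = g ![x, 0] := by
  obtain ⟨p, rfl⟩ := g.surjective p
  simp only [parallel_map_iff, g.injective.eq_iff]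
  simp only [Parallel, standardFrame, Matrix.cons_val_zero, Matrix.cons_val_one]
  constructor
  · intro h
    refine ⟨p 0, ?_⟩
    ext l; fin_cases l
    · simp
    · simp only [Fin.mk_one, Matrix.cons_val_one, Matrix.cons_val_zero]; linarith
  · rintro ⟨x, rfl⟩
    simp

variable (σ : TriangleSchema) {ι κ : Type}

lemma Expressible.hasCoordinates (e : Fin 3 → κ) (X Y q : κ) :
    Expressible fun (_ : TriangleDatabase σ) (_ : ι → Triangle) (a : κ → PlanePoint) =>
      HasCoordinates (a ∘ e) (a X) (a Y) (a q) :=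
  ((Expressible.parallel σ (some (e 0)) (some (e 2)) (some (e 0)) none).and
    ((Expressible.parallel σ (some (e 1)) (some (e 2)) (some Y) none).and
    ((Expressible.parallel σ (some (e 0)) (some (e 2)) (some X) (some q)).and
    (Expressible.parallel σ (some (e 0)) (some (e 1)) none (some q))))).exists_point

lemma Expressible.drawing_eq (i : ι) (u : Fin 3 → κ) :
    Expressible fun (_ : TriangleDatabase σ) (c : ι → Triangle) (a : κ → PlanePoint) =>
      (c i).drawing = Triangle.drawing fun j => a (u j) := by
  refine ((Expressible.forall_finite fun j => Expressible.mem σ (u j) i).and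
    ((Expressible.forall_finite fun j => Expressible.mem σ (u j) none).imp
      (Expressible.partOf σ (some i) none)).forall_triangle).congr fun D c a => ?_
  rw [← Triangle.triEq_iff, Triangle.TriEq, and_comm]
  refine and_congr ?_ ?_
  · exact ⟨fun h => h (fun j => a (u j)) fun j => Triangle.corner_mem_drawing _ j,
      fun h S hS => h.trans (Triangle.partOf_iff.2 hS)⟩
  · exact (Triangle.partOf_iff (T₁ := fun j => a (u j)) (T₂ := c i)).symm

/-- The triangles at the positions `u` are drawn as the triangles whose coordinates, with respect
to the frame at the positions `e`, are given by points of the first axis at the positions `z`. -/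
lemma Expressible.exists_tuple_hasCoordinates {k : ℕ} (e : Fin 3 → κ) (z : CoordIndex k → κ)
    (u : Fin k → ι) :
    Expressible fun (_ : TriangleDatabase σ) (c : ι → Triangle) (a : κ → PlanePoint) =>
      ∃ q : Fin k × Fin 3 → PlanePoint, (∀ p : Fin k × Fin 3, HasCoordinates (a ∘ e)
        (a (z (p.1, p.2, 0))) (a (z (p.1, p.2, 1))) (q p)) ∧
        ∀ i, (c (u i)).drawing = Triangle.drawing fun j => q (i, j) :=
  ((Expressible.forall_finite fun p : Fin k × Fin 3 => Expressible.hasCoordinates σ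
      (fun m => Sum.inl (e m)) (Sum.inl (z (p.1, p.2, 0))) (Sum.inl (z (p.1, p.2, 1)))
      (Sum.inr p)).and
    (Expressible.forall_finite fun i => Expressible.drawing_eq σ (u i)
      fun j => Sum.inr (i, j))).exists_points

variable {σ}

lemma exists_tuple_hasCoordinates_iff (g : Affinity) {k : ℕ} (x : CoordIndex k → ℝ)
    (c : Fin k → Triangle) :
    (∃ q : Fin k × Fin 3 → PlanePoint, (∀ p : Fin k × Fin 3, HasCoordinates (g ∘ standardFrame)
        (g ![x (p.1, p.2, 0), 0]) (g ![x (p.1, p.2, 1), 0]) (q p)) ∧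
        ∀ i, (c i).drawing = Triangle.drawing fun j => q (i, j)) ↔
      ∀ i, (c i).drawing = (g.mapTuple ((canonicalBijection k).symm x) i).drawing := by
  have hpt : ∀ i j, (canonicalBijection k).symm x i j = ![x (i, j, 0), x (i, j, 1)] := by
    intro i j
    ext l; fin_cases l <;> rfl
  simp only [hasCoordinates_iff]
  constructor
  · rintro ⟨q, hq, h⟩ i
    rw [h i]
    congr 1
    ext1 j
    rw [hq, Affinity.mapTuple, hpt]
  · intro h
    refine ⟨fun p => g ![x (p.1, p.2, 0), x (p.1, p.2, 1)], fun _ => rfl, fun i => ?_⟩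
    rw [h i]
    congr 1
    ext1 j
    rw [Affinity.mapTuple, hpt]

end Coordinates

section RealExpressible

variable {σ : TriangleSchema} {β γ : Type}

/-- A predicate `P` on databases and real tuples that can be expressed in the triangle logic
relative to an affine frame: if the frame is the image of the standard frame under an affinity `g`
and the real number `x` is represented by the point `g (x, 0)` of the first axis, then the truth of
`P` in `D'` is expressed in the database `g D'`. -/
def RealExpressible (P : TriangleDatabase σ → (β → ℝ) → Prop) : Prop :=
  ∃ Q : TriangleDatabase σ → (Empty → Triangle) → (Fin 3 ⊕ β → PlanePoint) → Prop,
    Expressible Q ∧ ∀ (g : Affinity) (D D' : TriangleDatabase σ), D'.IsImage g D → ∀ c x,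
      Q D c (Sum.elim (g ∘ standardFrame) fun b => g ![x b, 0]) ↔ P D' x

namespace RealExpressible

variable {P Q : TriangleDatabase σ → (β → ℝ) → Prop}

lemma congr (hP : RealExpressible P) (h : ∀ D x, P D x ↔ Q D x) : RealExpressible Q := by
  have : P = Q := by ext; exact h _ _
  rwa [← this]

lemma not (hP : RealExpressible P) : RealExpressible fun D x => ¬ P D x := by
  obtain ⟨P', hP', h⟩ := hP
  exact ⟨_, hP'.not, fun g D D' hD c x => not_congr (h g D D' hD c x)⟩

lemma and (hP : RealExpressible P) (hQ : RealExpressible Q) :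
    RealExpressible fun D x => P D x ∧ Q D x := by
  obtain ⟨P', hP', h⟩ := hP
  obtain ⟨Q', hQ', h'⟩ := hQ
  exact ⟨_, hP'.and hQ', fun g D D' hD c x => and_congr (h g D D' hD c x) (h' g D D' hD c x)⟩

lemma or (hP : RealExpressible P) (hQ : RealExpressible Q) :
    RealExpressible fun D x => P D x ∨ Q D x := by
  obtain ⟨P', hP', h⟩ := hP
  obtain ⟨Q', hQ', h'⟩ := hQ
  exact ⟨_, hP'.or hQ', fun g D D' hD c x => or_congr (h g D D' hD c x) (h' g D D' hD c x)⟩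

lemma forall_finite {τ : Type} [Finite τ] {P : τ → TriangleDatabase σ → (β → ℝ) → Prop}
    (hP : ∀ t, RealExpressible (P t)) : RealExpressible fun D x => ∀ t, P t D x := by
  choose P' hP' h using hP
  exact ⟨_, Expressible.forall_finite hP', fun g D D' hD c x =>
    forall_congr' fun t => h t g D D' hD c x⟩

lemma reindex (hP : RealExpressible P) (f : β → γ) :
    RealExpressible fun D (x : γ → ℝ) => P D (x ∘ f) := by
  obtain ⟨P', hP', h⟩ := hP
  refine ⟨_, hP'.reindex id (Sum.map id f), fun g D D' hD c x => ?_⟩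
  rw [Sum.elim_comp_map]
  exact h g D D' hD c _

lemma exists_option {P : TriangleDatabase σ → (Option β → ℝ) → Prop} (hP : RealExpressible P) :
    RealExpressible fun D (x : β → ℝ) => ∃ t, P D (fun o => o.elim t x) := by
  obtain ⟨P', hP', h⟩ := hP
  have hE := ((Expressible.parallel σ (ι := Empty) (κ := Option (Fin 3 ⊕ β)) (some (Sum.inl 0))
    (some (Sum.inl 1)) (some (Sum.inl 0)) none).and (hP'.reindex id
      (Sum.elim (fun i => some (Sum.inl i)) fun o : Option β =>
        o.elim none fun b => some (Sum.inr b)))).exists_point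
  refine ⟨_, hE, fun g D D' hD c x => ?_⟩
  simp only [Option.elim_some, Option.elim_none, Sum.elim_inl, Function.comp,
    exists_eq_axis_iff]
  have key : ∀ t : ℝ, P' D c (fun s => ((Sum.elim (fun i => some (Sum.inl i)) (fun o : Option β =>
      o.elim none fun b => some (Sum.inr b)) s : Option (Fin 3 ⊕ β))).elim (g ![t, 0])
        (Sum.elim (fun i => g (standardFrame i)) fun b => g ![x b, 0])) ↔
      P D' (fun o => o.elim t x) := by
    intro t
    rw [← h g D D' hD c]
    convert Iff.rfl using 2
    ext1 s
    rcases s with i | _ | b <;> rfl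
  constructor
  · rintro ⟨_, ⟨t, rfl⟩, hp⟩
    exact ⟨t, (key t).1 hp⟩
  · rintro ⟨t, ht⟩
    exact ⟨_, ⟨t, rfl⟩, (key t).2 ht⟩

lemma exists_family [Finite γ] {P : TriangleDatabase σ → (β ⊕ γ → ℝ) → Prop}
    (hP : RealExpressible P) :
    RealExpressible fun D (x : β → ℝ) => ∃ z : γ → ℝ, P D (Sum.elim x z) :=
  exists_family_of_exists (fun _ P => RealExpressible P) (fun _ _ e _ h => h.reindex e)
    (fun _ _ h => h.exists_option) γ β P hP

variable (σ)

/-- Addition of points of the first axis by a construction with parallel lines; the auxiliary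
point is `(x j, 1)`. -/
lemma add (i j k : β) :
    RealExpressible fun (_ : TriangleDatabase σ) (x : β → ℝ) => x i + x j = x k := by
  refine ⟨_, ((Expressible.parallel σ (some (Sum.inl 2)) none (some (Sum.inl 0))
      (some (Sum.inl 1))).and
    ((Expressible.parallel σ (some (Sum.inr j)) none (some (Sum.inl 0)) (some (Sum.inl 2))).and
    (Expressible.parallel σ (some (Sum.inl 2)) (some (Sum.inr i)) none
      (some (Sum.inr k))))).exists_point, fun g D D' _ c x => ?_⟩
  simp only [Option.elim_some, Option.elim_none, Sum.elim_inl, Sum.elim_inr, Function.comp]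
  refine g.surjective.exists.trans ?_
  simp only [parallel_map_iff]
  simp only [Parallel, standardFrame, Matrix.cons_val_zero, Matrix.cons_val_one, Matrix.cons_val]
  constructor
  · rintro ⟨p, h1, h2, h3⟩
    obtain hp1 : p 1 = 1 := by linarith
    rw [hp1] at h3
    linarith
  · intro h
    refine ⟨![x j, 1], ?_⟩
    simp only [Matrix.cons_val_zero, Matrix.cons_val_one]
    refine ⟨by ring, by ring, by linarith⟩

/-- Multiplication of points of the first axis by similar triangles; the auxiliary points are
`(0, x j)` and `(0, x i * x j)`. -/
lemma mul (i j k : β) :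
    RealExpressible fun (_ : TriangleDatabase σ) (x : β → ℝ) => x i * x j = x k := by
  refine ⟨_, ((Expressible.parallel σ (some (some (Sum.inl 0))) (some (some (Sum.inl 2)))
      (some (some (Sum.inl 0))) none).and
    ((Expressible.parallel σ (some (some (Sum.inl 0))) (some (some (Sum.inl 2)))
      (some (some (Sum.inl 0))) (some none)).and
    ((Expressible.parallel σ (some (some (Sum.inl 1))) (some (some (Sum.inl 2)))
      (some (some (Sum.inr j))) none).and
    ((Expressible.parallel σ (some (some (Sum.inl 1))) none
      (some (some (Sum.inr i))) (some none)).and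
    (Expressible.parallel σ (some (some (Sum.inl 1))) (some (some (Sum.inl 2)))
      (some (some (Sum.inr k))) (some none)))))).exists_point.exists_point,
    fun g D D' _ c x => ?_⟩
  simp only [Option.elim_some, Option.elim_none, Sum.elim_inl, Sum.elim_inr, Function.comp]
  refine (g.surjective.exists.trans (exists_congr fun _ => g.surjective.exists)).trans ?_
  simp only [parallel_map_iff]
  simp only [Parallel, standardFrame, Matrix.cons_val_zero, Matrix.cons_val_one, Matrix.cons_val]
  constructor
  · rintro ⟨q, p, h1, h2, h3, h4, h5⟩
    obtain hp0 : p 0 = 0 := by linarith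
    obtain hq0 : q 0 = 0 := by linarith
    obtain hp1 : p 1 = x j := by linarith
    obtain hq1 : q 1 = x k := by linarith
    rw [hp0, hq0, hp1, hq1] at h4
    linarith
  · intro h
    refine ⟨![0, x i * x j], ![0, x j], ?_⟩
    simp only [Matrix.cons_val_zero, Matrix.cons_val_one]
    refine ⟨by ring, by ring, by ring, by ring, by linarith⟩

lemma eq_zero (i : β) : RealExpressible fun (_ : TriangleDatabase σ) (x : β → ℝ) => x i = 0 :=
  (add σ i i i).congr fun _ x => by simp

lemma eq_one (i : β) : RealExpressible fun (_ : TriangleDatabase σ) (x : β → ℝ) => x i = 1 := by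
  refine ⟨_, Expressible.pointEq σ (Sum.inr i) (Sum.inl 1), fun g D D' _ c x => ?_⟩
  simp only [Sum.elim_inl, Sum.elim_inr, Function.comp, g.injective.eq_iff, standardFrame]
  simp

lemma eq (i j : β) : RealExpressible fun (_ : TriangleDatabase σ) (x : β → ℝ) => x i = x j := by
  refine ⟨_, Expressible.pointEq σ (Sum.inr i) (Sum.inr j), fun g D D' _ c x => ?_⟩
  simp [g.injective.eq_iff]

lemma pos (i : β) : RealExpressible fun (_ : TriangleDatabase σ) (x : β → ℝ) => 0 < x i := by
  refine ((eq_zero σ i).not.and (mul σ none none (some i)).exists_option).congr fun D x => ?_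
  simp only [Option.elim_none, Option.elim_some]
  constructor
  · rintro ⟨h0, t, ht⟩
    exact lt_of_le_of_ne (ht ▸ mul_self_nonneg t) (Ne.symm h0)
  · exact fun h => ⟨h.ne', _, Real.mul_self_sqrt h.le⟩

/-- If the graph of a binary operation is expressible, then so is its composition with functions
whose graphs are expressible. -/
lemma graph_comp₂ {op : ℝ → ℝ → ℝ}
    (hop : ∀ {γ : Type} (i j k : γ),
      RealExpressible fun (_ : TriangleDatabase σ) (x : γ → ℝ) => op (x i) (x j) = x k)
    {f₁ f₂ : (β → ℝ) → ℝ}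
    (h₁ : RealExpressible fun (_ : TriangleDatabase σ) (x : Option β → ℝ) =>
      x none = f₁ (x ∘ some))
    (h₂ : RealExpressible fun (_ : TriangleDatabase σ) (x : Option β → ℝ) =>
      x none = f₂ (x ∘ some)) :
    RealExpressible fun (_ : TriangleDatabase σ) (x : Option β → ℝ) =>
      x none = op (f₁ (x ∘ some)) (f₂ (x ∘ some)) := by
  have h := ((h₁.reindex (γ := Option (Option (Option β)))
      fun o => o.elim none fun b => some (some (some b))).and
    ((h₂.reindex (γ := Option (Option (Option β)))
      fun o => o.elim (some none) fun b => some (some (some b))).and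
    (hop none (some none) (some (some none))))).exists_option.exists_option
  refine h.congr fun D x => ?_
  constructor
  · rintro ⟨t₂, t₁, h1, h2, h3⟩
    exact h3.symm.trans (congrArg₂ op h1 h2)
  · intro h0
    exact ⟨_, _, rfl, rfl, h0.symm⟩

lemma graph_int (r : ℤ) : RealExpressible fun (_ : TriangleDatabase σ) (x : Option β → ℝ) =>
    x none = r := by
  have hneg : ∀ {γ : Type} (i j k : γ), RealExpressible
      fun (_ : TriangleDatabase σ) (x : γ → ℝ) => x i - x j = x k := fun i j k =>
    (add σ k j i).congr fun D x => by rw [sub_eq_iff_eq_add, eq_comm]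
  induction r using Int.induction_on with
  | zero => exact (eq_zero σ none).congr fun D x => by simp
  | succ n ih =>
    exact (graph_comp₂ σ (add σ) (f₁ := fun _ => ((n : ℤ) : ℝ)) (f₂ := fun _ => 1) ih (eq_one σ none)).congr
      fun D x => by push_cast; rfl
  | pred n ih =>
    exact (graph_comp₂ σ hneg (f₁ := fun _ => ((-n : ℤ) : ℝ)) (f₂ := fun _ => 1) ih (eq_one σ none)).congr
      fun D x => by push_cast; rfl

lemma graph_polynomial (p : MvPolynomial β ℤ) : RealExpressible
    fun (_ : TriangleDatabase σ) (x : Option β → ℝ) => x none = MvPolynomial.aeval (x ∘ some) p := by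
  induction p using MvPolynomial.induction_on with
  | C r => exact (graph_int σ r).congr fun D x => by simp
  | add p q hp hq =>
    exact (graph_comp₂ σ (add σ) (f₁ := fun x => MvPolynomial.aeval x p)
      (f₂ := fun x => MvPolynomial.aeval x q) hp hq).congr fun D x => by simp
  | mul_X p i hp =>
    exact (graph_comp₂ σ (mul σ) (f₁ := fun x => MvPolynomial.aeval x p)
      (f₂ := fun x => x i) hp (eq σ none (some i))).congr
      fun D x => by simp

lemma polynomial_pos (p : MvPolynomial β ℤ) : RealExpressible
    fun (_ : TriangleDatabase σ) (x : β → ℝ) => 0 < (MvPolynomial.aeval x p : ℝ) :=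
  ((graph_polynomial σ p).and (pos σ none)).exists_option.congr fun D x => by
    constructor
    · rintro ⟨t, ht, h⟩
      exact lt_of_lt_of_eq h ht
    · exact fun h => ⟨_, rfl, h⟩

variable {σ}

lemma rel (R : σ.Name) : RealExpressible fun (D : TriangleDatabase σ) x =>
    x ∈ canonicalBijection (σ.arity R) '' (D.rel R).carrier := by
  have hE := ((Expressible.exists_tuple_hasCoordinates σ (ι := Empty ⊕ Fin (σ.arity R))
    (κ := Fin 3 ⊕ CoordIndex (σ.arity R)) Sum.inl Sum.inr Sum.inr).and
    (Expressible.rel R Sum.inr)).exists_triangles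
  refine ⟨_, hE, fun g D D' hD c x => ?_⟩
  beta_reduce
  rw [Equiv.image_eq_preimage_symm]
  have key := fun T => exists_tuple_hasCoordinates_iff g x T
  simp only [Sum.elim_comp_inl, Sum.elim_inr, Sum.elim_comp_inr, key]
  rw [Set.mem_preimage, ← g.mapTuple_injective.mem_set_image (s := (D'.rel R).carrier), ← hD R]
  constructor
  · rintro ⟨T, hT, hTR⟩
    exact (D.rel R).consistent _ _ hT hTR
  · exact fun h => ⟨_, fun _ => rfl, h⟩

end RealExpressible

/-- Every real formula can be evaluated in the triangle logic relative to a frame. -/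
lemma RealFormula.realExpressible {α : Type} {n : ℕ} (ψ : RealFormula σ α n) :
    RealExpressible fun (D : TriangleDatabase σ) (z : α ⊕ Fin n → ℝ) =>
      ψ.Realize D (fun a => z (Sum.inl a)) (fun i => z (Sum.inr i)) := by
  have hex : ∀ {n : ℕ} {ψ : RealFormula σ α (n + 1)}, (RealExpressible
      fun (D : TriangleDatabase σ) (z : α ⊕ Fin (n + 1) → ℝ) =>
        ψ.Realize D (fun a => z (Sum.inl a)) (fun i => z (Sum.inr i))) →
      RealExpressible fun (D : TriangleDatabase σ) (z : α ⊕ Fin n → ℝ) => ∃ t,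
        ψ.Realize D (fun a => z (Sum.inl a))
          (Fin.snoc (α := fun _ => ℝ) (fun i => z (Sum.inr i)) t) := by
    intro n ψ h
    refine (h.reindex (Sum.elim (fun a => some (Sum.inl a)) (Fin.snoc
      (α := fun _ => Option (α ⊕ Fin n)) (fun i => some (Sum.inr i)) none))).exists_option.congr
      fun D z => exists_congr fun t => ?_
    simp only [Function.comp, Sum.elim_inl, Sum.elim_inr, Option.elim_some]
    convert Iff.rfl using 2
    ext i
    refine Fin.lastCases ?_ (fun i => ?_) i <;> simp
  have helim : ∀ {n : ℕ} (z : α ⊕ Fin n → ℝ),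
      Sum.elim (fun a => z (Sum.inl a)) (fun i => z (Sum.inr i)) = z := fun z =>
    Sum.elim_comp_inl_inr z
  induction ψ with
  | pos p =>
    exact (RealExpressible.polynomial_pos σ p).congr fun D z => by
      rw [RealFormula.Realize, helim]
  | @rel n R t =>
    have hE := ((RealExpressible.forall_finite fun l : CoordIndex (σ.arity R) =>
      (RealExpressible.graph_polynomial σ (t l)).reindex
        (γ := (α ⊕ Fin n) ⊕ CoordIndex (σ.arity R))
        (fun o => o.elim (Sum.inr l) Sum.inl)).and
      ((RealExpressible.rel R).reindex Sum.inr)).exists_family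
    refine hE.congr fun D z => ?_
    rw [RealFormula.Realize, helim]
    constructor
    · rintro ⟨y, hy, h⟩
      have : y = fun l => MvPolynomial.aeval z (t l) := funext hy
      rwa [← this]
    · exact fun h => ⟨_, fun _ => rfl, h⟩
  | not _ ih => exact ih.not
  | and _ _ ih₁ ih₂ => exact ih₁.and ih₂
  | or _ _ ih₁ ih₂ => exact ih₁.or ih₂
  | ex _ ih => exact hex ih
  | @all n ψ ih =>
    exact (hex (ψ := ψ.not) ih.not).not.congr fun D z => by simp [RealFormula.Realize]

end RealExpressible

/-! ### Generic rational frames -/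

section Generic

/-- Along a polynomial map, membership in a semialgebraic set is locally constant off the zero set
of some nonzero polynomial. -/
lemma IsSemialgebraic.exists_polynomial_eventually_iff {κ β : Type} {S : Set (κ → ℝ)}
    (hS : IsSemialgebraic S) (t : κ → MvPolynomial β ℝ) :
    ∃ R : MvPolynomial β ℝ, R ≠ 0 ∧ ∀ e : β → ℝ, MvPolynomial.eval e R ≠ 0 →
      ∀ᶠ e' in nhds e, ((fun k => MvPolynomial.eval e' (t k)) ∈ S ↔
        (fun k => MvPolynomial.eval e (t k)) ∈ S) := by
  induction hS with
  | pos p =>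
    have hq : ∀ e : β → ℝ, MvPolynomial.aeval (fun k => MvPolynomial.eval e (t k)) p =
        MvPolynomial.eval e (MvPolynomial.aeval t p) := by
      intro e
      induction p using MvPolynomial.induction_on with
      | C r => simp
      | add p q hp hq => simp [hp, hq]
      | mul_X p i hp => simp [hp]
    simp only [Set.mem_ofPred_eq, hq]
    by_cases h0 : MvPolynomial.aeval t p = 0
    · exact ⟨1, one_ne_zero, fun e _ => by simp [h0]⟩
    · refine ⟨_, h0, fun e he => ?_⟩
      have hc := (MvPolynomial.continuous_eval (MvPolynomial.aeval t p)).tendsto e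
      rcases lt_or_gt_of_ne he with h | h
      · filter_upwards [hc.eventually_lt_const h] with e' he'
        exact iff_of_false (not_lt.2 he'.le) (not_lt.2 h.le)
      · filter_upwards [hc.eventually_const_lt h] with e' he'
        exact iff_of_true he' h
  | compl _ ih =>
    obtain ⟨R, hR, h⟩ := ih
    exact ⟨R, hR, fun e he => (h e he).mono fun e' h' => not_congr h'⟩
  | inter _ _ ih₁ ih₂ =>
    obtain ⟨R₁, hR₁, h₁⟩ := ih₁
    obtain ⟨R₂, hR₂, h₂⟩ := ih₂
    refine ⟨R₁ * R₂, mul_ne_zero hR₁ hR₂, fun e he => ?_⟩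
    rw [map_mul] at he
    filter_upwards [h₁ e (left_ne_zero_of_mul he), h₂ e (right_ne_zero_of_mul he)] with e' h h'
    exact and_congr h h'
  | union _ _ ih₁ ih₂ =>
    obtain ⟨R₁, hR₁, h₁⟩ := ih₁
    obtain ⟨R₂, hR₂, h₂⟩ := ih₂
    refine ⟨R₁ * R₂, mul_ne_zero hR₁ hR₂, fun e he => ?_⟩
    rw [map_mul] at he
    filter_upwards [h₁ e (left_ne_zero_of_mul he), h₂ e (right_ne_zero_of_mul he)] with e' h h'
    exact or_congr h h'

lemma MvPolynomial.exists_rat_eval_ne_zero {β : Type} {R : MvPolynomial β ℝ}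
    (hR : R ≠ 0) : ∃ r : β → ℚ, MvPolynomial.eval (fun b => (r b : ℝ)) R ≠ 0 := by
  by_contra! h
  apply hR
  refine MvPolynomial.funext_set (fun _ : β => Set.range ((↑) : ℚ → ℝ))
    (fun _ => Set.infinite_range_of_injective Rat.cast_injective) fun x hx => ?_
  have h1 : ∀ b, ∃ r : ℚ, (r : ℝ) = x b := fun b => hx b (Set.mem_univ b)
  choose r hr using h1
  rw [map_zero, ← h r]
  congr 1
  congr 1
  ext b
  exact (hr b).symm

lemma IsSemialgebraic.pos_rat {β : Type} (q : MvPolynomial β ℚ) :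
    IsSemialgebraic {x : β → ℝ | 0 < (MvPolynomial.aeval x q : ℝ)} := by
  obtain ⟨N, hN, p, hp⟩ : ∃ N : ℕ, 0 < N ∧ ∃ p : MvPolynomial β ℤ,
      MvPolynomial.map (Int.castRingHom ℚ) p = MvPolynomial.C (N : ℚ) * q := by
    induction q using MvPolynomial.induction_on with
    | C r =>
      refine ⟨r.den, r.pos, MvPolynomial.C r.num, ?_⟩
      rw [MvPolynomial.map_C, ← map_mul, mul_comm, Rat.mul_den_eq_num]
      rfl
    | add q₁ q₂ ih₁ ih₂ =>
      obtain ⟨N₁, hN₁, p₁, hp₁⟩ := ih₁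
      obtain ⟨N₂, hN₂, p₂, hp₂⟩ := ih₂
      refine ⟨N₁ * N₂, Nat.mul_pos hN₁ hN₂, N₂ * p₁ + N₁ * p₂, ?_⟩
      simp only [map_add, map_mul, map_natCast, hp₁, hp₂, Nat.cast_mul]
      ring
    | mul_X q i ih =>
      obtain ⟨N, hN, p, hp⟩ := ih
      refine ⟨N, hN, p * MvPolynomial.X i, ?_⟩
      rw [map_mul, hp, MvPolynomial.map_X, mul_assoc]
  convert IsSemialgebraic.pos p using 1
  ext x
  have h1 : (MvPolynomial.aeval x p : ℝ) = N * MvPolynomial.aeval x q := by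
    have h2 := congrArg (MvPolynomial.aeval (R := ℚ) x : MvPolynomial β ℚ → ℝ) hp
    rw [← algebraMap_int_eq, MvPolynomial.aeval_map_algebraMap] at h2
    simpa using h2
  rw [Set.mem_ofPred_eq, Set.mem_ofPred_eq, h1, mul_pos_iff_of_pos_left (by exact_mod_cast hN)]

lemma IsSemialgebraic.preimage_rat {κ β : Type} {S : Set (κ → ℝ)} (hS : IsSemialgebraic S)
    (t : κ → MvPolynomial β ℚ) :
    IsSemialgebraic {x : β → ℝ | (fun k => (MvPolynomial.aeval x (t k) : ℝ)) ∈ S} := by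
  induction hS with
  | pos p =>
    convert IsSemialgebraic.pos_rat (MvPolynomial.aeval t p) using 1
    ext x
    simp only [Set.mem_ofPred_eq]
    convert Iff.rfl using 2
    induction p using MvPolynomial.induction_on with
    | C r => simp
    | add p q hp hq => simp [hp, hq]
    | mul_X p i hp => simp [hp]
  | compl _ ih => exact ih.compl
  | inter _ _ ih₁ ih₂ => exact ih₁.inter ih₂
  | union _ _ ih₁ ih₂ => exact ih₁.union ih₂

end Generic

section Frames

variable {σ : TriangleSchema}

/-- Three points that are not collinear are the image of the standard frame under an affinity. -/
lemma exists_affinity_of_not_parallel {e : Fin 3 → PlanePoint}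
    (he : ¬ Parallel (e 0) (e 1) (e 0) (e 2)) :
    ∃ g : Affinity, (∀ x l, g x l = e 0 l + x 0 * (e 1 l - e 0 l) + x 1 * (e 2 l - e 0 l)) ∧
      g ∘ standardFrame = e := by
  let L : PlanePoint →ₗ[ℝ] PlanePoint :=
    Fintype.linearCombination ℝ ![e 1 - e 0, e 2 - e 0]
  have hL : ∀ x l, L x l = x 0 * (e 1 l - e 0 l) + x 1 * (e 2 l - e 0 l) := by
    intro x l
    simp [L, Fintype.linearCombination_apply, Fin.sum_univ_two]
  have hinj : Function.Injective L := by
    rw [← LinearMap.ker_eq_bot, LinearMap.ker_eq_bot']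
    intro x hx
    have h0 := congrFun hx 0
    have h1 := congrFun hx 1
    rw [hL, Pi.zero_apply] at h0 h1
    have hd : (e 1 0 - e 0 0) * (e 2 1 - e 0 1) - (e 1 1 - e 0 1) * (e 2 0 - e 0 0) ≠ 0 :=
      sub_ne_zero.2 he
    ext l; fin_cases l
    · apply (mul_eq_zero.1 (_ : _ * x 0 = 0)).resolve_left hd
      linear_combination (e 2 1 - e 0 1) * h0 - (e 2 0 - e 0 0) * h1
    · apply (mul_eq_zero.1 (_ : _ * x 1 = 0)).resolve_left hd
      linear_combination (e 1 0 - e 0 0) * h1 - (e 1 1 - e 0 1) * h0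
  let g : Affinity := (LinearEquiv.ofInjectiveEndo L hinj).toAffineEquiv.trans
    (AffineEquiv.constVAdd ℝ PlanePoint (e 0))
  have hg : ∀ x l, g x l = e 0 l + x 0 * (e 1 l - e 0 l) + x 1 * (e 2 l - e 0 l) := by
    intro x l
    have : g x = e 0 + L x := rfl
    rw [this, Pi.add_apply, hL]
    ring
  refine ⟨g, hg, ?_⟩
  ext i l
  rw [Function.comp, hg]
  fin_cases i <;> simp [standardFrame]

/-- The inverse image of a database under an affinity with rational coefficients is again a
database. -/
lemma TriangleDatabase.exists_isImage_of_rat (g : Affinity) (r : Fin 3 → Fin 2 → ℚ)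
    (hg : ∀ x l, g x l = r 0 l + x 0 * (r 1 l - r 0 l) + x 1 * (r 2 l - r 0 l))
    (D : TriangleDatabase σ) : ∃ D' : TriangleDatabase σ, D'.IsImage g D := by
  refine ⟨⟨fun R => ⟨{c | g.mapTuple c ∈ (D.rel R).carrier}, ?_, ?_⟩⟩, fun R => ?_⟩
  · convert (D.rel R).semialgebraic.preimage_rat (β := CoordIndex (σ.arity R))
      (fun p => MvPolynomial.C (r 0 p.2.2) +
        MvPolynomial.X (p.1, p.2.1, 0) * MvPolynomial.C (r 1 p.2.2 - r 0 p.2.2) +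
        MvPolynomial.X (p.1, p.2.1, 1) * MvPolynomial.C (r 2 p.2.2 - r 0 p.2.2)) using 1
    ext x
    rw [Equiv.image_eq_preimage_symm, Equiv.image_eq_preimage_symm]
    simp only [Set.mem_preimage, Set.mem_ofPred_eq]
    convert Iff.rfl using 2
    ext i j l
    simp [canonicalBijection, Affinity.mapTuple, hg]
  · intro c c' h hc
    refine (D.rel R).consistent _ _ (fun i => ?_) hc
    exact (g.drawing_mapTriangle (c i)).trans ((congrArg (g '' ·) (h i)).trans
      (g.drawing_mapTriangle (c' i)).symm)
  · ext c
    constructor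
    · intro hc
      exact ⟨Affinity.mapTuple g.symm c, by
        rwa [Set.mem_ofPred_eq, g.mapTuple_mapTuple_symm], g.mapTuple_mapTuple_symm c⟩
    · rintro ⟨c, hc, rfl⟩
      exact hc

/-- A triangle that contains three points that are not collinear contains a rational point. -/
lemma Triangle.exists_rat_mem_drawing {T : Triangle} {p : Fin 3 → PlanePoint}
    (hp : ∀ i, p i ∈ T.drawing) (h : ¬ Parallel (p 0) (p 1) (p 0) (p 2)) :
    ∃ r : Fin 2 → ℚ, (fun l => (r l : ℝ)) ∈ T.drawing := by
  obtain ⟨g, hg, -⟩ := exists_affinity_of_not_parallel h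
  have hcont : Continuous g.symm :=
    AffineMap.continuous_of_finiteDimensional (g.symm : PlanePoint →ᵃ[ℝ] PlanePoint)
  have hopen : IsOpen {y : PlanePoint | 0 < g.symm y 0 ∧ 0 < g.symm y 1 ∧
      g.symm y 0 + g.symm y 1 < 1} := by
    have h0 : Continuous fun y => g.symm y 0 := (continuous_apply 0).comp hcont
    have h1 : Continuous fun y => g.symm y 1 := (continuous_apply 1).comp hcont
    exact (isOpen_lt continuous_const h0).inter ((isOpen_lt continuous_const h1).inter
      (isOpen_lt (h0.add h1) continuous_const))
  have hdense : DenseRange (Pi.map fun (_ : Fin 2) (q : ℚ) => (q : ℝ)) :=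
    DenseRange.piMap fun _ => Rat.denseRange_cast
  obtain ⟨r, h0, h1, h2⟩ := hdense.exists_mem_open hopen
    ⟨g ![1 / 4, 1 / 4], by simp; norm_num⟩
  refine ⟨r, ?_⟩
  set y : PlanePoint := Pi.map (fun (_ : Fin 2) (q : ℚ) => (q : ℝ)) r with hy
  have hmem : ∑ i, (![1 - g.symm y 0 - g.symm y 1, g.symm y 0, g.symm y 1] : Fin 3 → ℝ) i • p i ∈
      T.drawing := by
    refine (convex_convexHull ℝ _).sum_mem ?_ ?_ fun i _ => hp i
    · intro i _
      fin_cases i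
      · simp; linarith
      · simpa using h0.le
      · simpa using h1.le
    · simp only [Fin.sum_univ_three, Matrix.cons_val_zero, Matrix.cons_val_one, Matrix.cons_val]
      ring
  convert hmem using 1
  have : y = g (g.symm y) := (g.apply_symm_apply y).symm
  ext l
  change y l = _
  rw [this, hg]
  simp only [AffineEquiv.symm_apply_apply, Fin.sum_univ_three, Matrix.cons_val_zero,
    Matrix.cons_val_one, Matrix.cons_val, Pi.add_apply, Pi.smul_apply, smul_eq_mul]
  ring

/-- Every point is a corner of arbitrarily small triangles that are not degenerate. -/
lemma exists_triangle_subset_closedBall (p : PlanePoint) {ε : ℝ} (hε : 0 < ε) :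
    ∃ T : Triangle, T.drawing ⊆ Metric.closedBall p ε ∧ ¬ Parallel (T 0) (T 1) (T 0) (T 2) := by
  refine ⟨![p, ![p 0 + ε, p 1], ![p 0, p 1 + ε]], convexHull_min ?_ (convex_closedBall p ε), ?_⟩
  · rintro _ ⟨i, rfl⟩
    rw [Metric.mem_closedBall, dist_pi_le_iff hε.le]
    intro l
    fin_cases i <;> fin_cases l <;> simp [abs_of_pos hε, hε.le]
  · simp [Parallel, hε.ne']

end Frames

section Completeness

variable {σ : TriangleSchema} {k : ℕ} {Q : TriangleQuery σ k}

/-- The result of an affine-generic first-order query is expressed relative to a frame. Only those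
frames count for which the inverse image of the database under the affinity of the frame is again
a database. -/
lemma TriangleQuery.exists_expressible_of_frame (hFO : Q.IsFirstOrder) (hgen : Q.AffineGeneric) :
    ∃ A : TriangleDatabase σ → (Fin k → Triangle) → (Fin 3 → PlanePoint) → Prop,
      Expressible A ∧ (∀ D c e, A D c e → ¬ Parallel (e 0) (e 1) (e 0) (e 2)) ∧
      ∀ (g : Affinity) (D D' : TriangleDatabase σ), D'.IsImage g D → ∀ c,
        A D c (g ∘ standardFrame) ↔ c ∈ (Q D).carrier := by
  obtain ⟨ψ, hψ⟩ := hFO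
  obtain ⟨P, hP, hPψ⟩ := ψ.realExpressible.reindex
    (Sum.elim id Fin.elim0 : CoordIndex k ⊕ Fin 0 → CoordIndex k)
  have hE := (Expressible.parallel σ (ι := Fin k) (0 : Fin 3) 1 0 2).not.and
    ((Expressible.forall_finite fun l : CoordIndex k => Expressible.parallel σ (ι := Fin k)
      (Sum.inl (0 : Fin 3)) (Sum.inl 1) (Sum.inl 0) (Sum.inr l)).and
    ((Expressible.exists_tuple_hasCoordinates σ (Sum.inl : Fin 3 → Fin 3 ⊕ CoordIndex k)
      Sum.inr id).and (hP.reindex Empty.elim id))).exists_points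
  refine ⟨_, hE, fun D c e h => h.1, fun g D D' hD c => ?_⟩
  have hframe : ¬ Parallel (g (standardFrame 0)) (g (standardFrame 1)) (g (standardFrame 0))
      (g (standardFrame 2)) := by
    rw [parallel_map_iff]
    simp [Parallel, standardFrame]
  have hQ : ∀ x : CoordIndex k → ℝ, P D (c ∘ Empty.elim)
      (Sum.elim (g ∘ standardFrame) fun b => g ![x b, 0]) ↔
        (canonicalBijection k).symm x ∈ (Q D').carrier := by
    intro x
    rw [hPψ g D D' hD, ← Set.mem_preimage, ← Equiv.image_eq_preimage_symm, hψ D',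
      Set.mem_ofPred_eq]
    convert Iff.rfl using 2
    rfl
  simp only [Function.comp, Sum.elim_inl, Sum.elim_inr, hframe, not_false_eq_true, true_and, id,
    exists_eq_axis_iff]
  constructor
  · rintro ⟨X, hX, hc, hPX⟩
    choose x hx using hX
    obtain rfl : X = fun b => g ![x b, 0] := funext hx
    have h1 := (exists_tuple_hasCoordinates_iff g x c).1 hc
    refine (Q D).consistent _ _ (fun i => (h1 i).symm) ?_
    rw [hgen g D' D hD]
    exact ⟨_, (hQ x).1 hPX, rfl⟩
  · intro hc
    rw [hgen g D' D hD] at hc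
    obtain ⟨c', hc', rfl⟩ := hc
    refine ⟨fun b => g ![canonicalBijection k c' b, 0], fun l => ⟨_, rfl⟩, ?_, ?_⟩
    · refine (exists_tuple_hasCoordinates_iff g (canonicalBijection k c') _).2 fun i => ?_
      rw [Equiv.symm_apply_apply]
    · refine (hQ (canonicalBijection k c')).2 ?_
      rwa [Equiv.symm_apply_apply]

/-- If a predicate on frames that is expressible in the triangle logic holds for every rational
frame, then it holds for all frames whose points are chosen from suitable nondegenerate triangles:
in coordinates the predicate is semialgebraic, hence constant around a generic rational frame. -/
lemma Expressible.exists_triangles_of_rat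
    {A : TriangleDatabase σ → (Fin k → Triangle) → (Fin 3 → PlanePoint) → Prop}
    (hA : Expressible A) (D : TriangleDatabase σ) (c : Fin k → Triangle)
    (h : ∀ r : Fin 3 → Fin 2 → ℚ, let e : Fin 3 → PlanePoint := fun i l => (r i l : ℝ)
      ¬ Parallel (e 0) (e 1) (e 0) (e 2) → A D c e) :
    ∃ t : Fin 3 → Triangle, (∀ i, ¬ Parallel (t i 0) (t i 1) (t i 0) (t i 2)) ∧
      ∀ e : Fin 3 → PlanePoint, (∀ i, e i ∈ (t i).drawing) → A D c e := by
  obtain ⟨φ, hφ⟩ := hA (k + 3) (Fin.castAdd 3) (Fin.natAdd k)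
  let u : (Fin 3 → PlanePoint) → Fin (k + 3) → Triangle := fun e =>
    Fin.append c fun i => pointTriangle (e i)
  have hu : ∀ e, φ.Realize D (u e) ↔ A D c e := by
    intro e
    rw [hφ D (u e) e fun i => by simp [u, drawing_pointTriangle]]
    convert Iff.rfl using 2
    ext1 i
    simp [u]
  let s : CoordIndex (k + 3) → MvPolynomial (Fin 3 × Fin 2) ℝ := fun p =>
    Fin.addCases (fun i => MvPolynomial.C (c i p.2.1 p.2.2))
      (fun i => MvPolynomial.X (i, p.2.2)) p.1
  have hs : ∀ E : Fin 3 × Fin 2 → ℝ, (fun p => MvPolynomial.eval E (s p)) ∈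
      canonicalBijection (k + 3) '' {c | φ.Realize D c} ↔ A D c fun i l => E (i, l) := by
    intro E
    rw [← hu, Equiv.image_eq_preimage_symm, Set.mem_preimage, Set.mem_ofPred_eq]
    convert Iff.rfl using 2
    ext i j l
    refine Fin.addCases (fun i => ?_) (fun i => ?_) i <;>
      simp [u, s, canonicalBijection, pointTriangle]
  obtain ⟨R, hR, hloc⟩ := (φ.isSemialgebraic_realize D).exists_polynomial_eventually_iff s
  -- the determinant that decides whether three points form a frame
  let d : MvPolynomial (Fin 3 × Fin 2) ℝ :=
    (MvPolynomial.X (1, 0) - MvPolynomial.X (0, 0)) *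
      (MvPolynomial.X (2, 1) - MvPolynomial.X (0, 1)) -
    (MvPolynomial.X (1, 1) - MvPolynomial.X (0, 1)) *
      (MvPolynomial.X (2, 0) - MvPolynomial.X (0, 0))
  have hd : d ≠ 0 := by
    intro h0
    have := congrArg (MvPolynomial.eval fun p : Fin 3 × Fin 2 => standardFrame p.1 p.2) h0
    simp [d, standardFrame] at this
  obtain ⟨r, hr⟩ := MvPolynomial.exists_rat_eval_ne_zero (mul_ne_zero hR hd)
  rw [map_mul] at hr
  have hA₀ : A D c fun i l => (r (i, l) : ℝ) := by
    refine h (fun i l => r (i, l)) fun h0 => right_ne_zero_of_mul hr ?_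
    simpa [d, sub_eq_zero, Parallel] using h0
  obtain ⟨ε, hε, hball⟩ := Metric.eventually_nhds_iff.1 (hloc _ (left_ne_zero_of_mul hr))
  choose t ht ht' using fun i : Fin 3 =>
    exists_triangle_subset_closedBall (fun l => (r (i, l) : ℝ)) (half_pos hε)
  refine ⟨t, ht', fun e he => ?_⟩
  have hdist : dist (fun p : Fin 3 × Fin 2 => e p.1 p.2) (fun p => (r p : ℝ)) < ε := by
    rw [dist_pi_lt_iff hε]
    rintro ⟨i, l⟩
    exact ((dist_le_pi_dist (e i) _ l).trans (ht i (he i))).trans_lt (half_lt_self hε)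
  have h1 := hball hdist
  rw [hs, hs] at h1
  exact h1.2 hA₀

/-- Completeness: the formula says that there are three nondegenerate triangles such that the query
holds relative to every frame with one point chosen from each of them. -/
theorem TriangleQuery.exists_expresses (hFO : Q.IsFirstOrder) (hgen : Q.AffineGeneric) :
    ∃ φ : TriangleFormula σ k, φ.Expresses Q := by
  obtain ⟨A, hA, hAframe, hAQ⟩ := Q.exists_expressible_of_frame hFO hgen
  have hrat : ∀ D c (r : Fin 3 → Fin 2 → ℚ), let e : Fin 3 → PlanePoint := fun i l => (r i l : ℝ)
      ¬ Parallel (e 0) (e 1) (e 0) (e 2) → (A D c e ↔ c ∈ (Q D).carrier) := by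
    intro D c r e he
    obtain ⟨g, hg, hge⟩ := exists_affinity_of_not_parallel he
    obtain ⟨D', hD'⟩ := D.exists_isImage_of_rat g r hg
    rw [← hge]
    exact hAQ g D D' hD' c
  have hnondeg : Expressible fun (_ : TriangleDatabase σ) (c : Fin k ⊕ Fin 3 → Triangle)
      (_ : Empty → PlanePoint) => ∀ i : Fin 3, ∃ p : Fin 3 → PlanePoint,
        (∀ j, p j ∈ (c (Sum.inr i)).drawing) ∧ ¬ Parallel (p 0) (p 1) (p 0) (p 2) :=
    Expressible.forall_finite fun i => ((Expressible.forall_finite fun j : Fin 3 =>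
      Expressible.mem σ (κ := Empty ⊕ Fin 3) (Sum.inr j) (Sum.inr i)).and
      (Expressible.parallel σ (Sum.inr 0) (Sum.inr 1) (Sum.inr 0) (Sum.inr 2)).not).exists_points
  have hE := (hnondeg.and ((Expressible.forall_finite fun j : Fin 3 =>
      Expressible.mem σ (κ := Empty ⊕ Fin 3) (ι := Fin k ⊕ Fin 3) (Sum.inr j) (Sum.inr j)).imp
      (hA.reindex Sum.inl Sum.inr)).forall_points).exists_triangles
  obtain ⟨φ, hφ⟩ := hE k id Empty.elim
  refine ⟨φ, fun D => ?_⟩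
  ext c
  rw [Set.mem_ofPred_eq, hφ D c Empty.elim fun k => k.elim]
  constructor
  · intro hc
    obtain ⟨t, ht, htA⟩ := hA.exists_triangles_of_rat D c fun r hr => (hrat D c r hr).2 hc
    exact ⟨t, fun i => ⟨t i, fun j => (t i).corner_mem_drawing j, ht i⟩, fun e he => htA e he⟩
  · rintro ⟨t, ht, htA⟩
    have hpt : ∀ i, ∃ r : Fin 2 → ℚ, (fun l => (r l : ℝ)) ∈ (t i).drawing := by
      intro i
      obtain ⟨p, hp, hp'⟩ := ht i
      exact Triangle.exists_rat_mem_drawing hp hp'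
    choose r hr using hpt
    have hAr : A D c fun i l => (r i l : ℝ) := htA _ hr
    exact (hrat D c r (hAframe D c _ hAr)).1 hAr

end Completeness

theorem mainTheorem1 (σ : TriangleSchema) (k : ℕ) :
    (∀ φ : TriangleFormula σ k, ∃ Q : TriangleQuery σ k,
      φ.Expresses Q ∧ Q.IsFirstOrder ∧ Q.AffineGeneric) ∧
    (∀ Q : TriangleQuery σ k, Q.IsFirstOrder → Q.AffineGeneric →
      ∃ φ : TriangleFormula σ k, φ.Expresses Q) :=
  ⟨fun φ => ⟨φ.toQuery, fun _ => rfl, φ.isFirstOrder_toQuery, φ.affineGeneric_toQuery⟩,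
    fun _ hFO hgen => TriangleQuery.exists_expresses hFO hgen⟩
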